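/- Let $G=(V,E)$ be a finite simple split graph, that is, $V$ is the disjoint union of a clique $K$ and an independent set $I$, and let $w:V\to\mathbb R$; put $w(F)=\sum_{f\in F}w(f)$. A set $F\subseteq V$ is \emph{feasible} (for the vertex shelling antimatroid of $G$) if its elements can be ordered $f_1,\dots,f_m$ so that, for every $j$, the neighbours of $f_j$ in $G\setminus\{f_1,\dots,f_{j-1}\}$ form a clique. (1) There is a polynomial-time algorithm which, given $G$ (as a list of vertices $0,\dots,n-1$ and a list of edges) and $w$, finds a feasible set of maximum weight. Precisely: there are one fixed program $P$ and one fixed polynomial $p$ such that, for every split graph $G$ with $n$ vertices, every list of $m$ pairs representing exactly the edges of $G$, and all real weights $w$, the program $P$ halts after at most $p(n+m)$ steps and outputs a feasible set of maximum weight. Programs are while-programs for a random access machine with finitely many indirectly addressed arrays of natural numbers and of real numbers; every operation takes one step, the arithmetic operations are addition and subtraction (truncated at $0$ on natural numbers), the tests are Boolean combinations of comparisons, and the only real constant is $0$. The partition $V=K\uplus I$ is not part of the input. (2) The problem decomposes into $|I|+1$ maximum closure problems. For $u,v\in V$ write $u\prec v$ iff $u\in K$, $v\in I$ and $uv\in E$;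 a \emph{filter} of $(U,\prec)$, where $U\subseteq V$, is a set $H\subseteq U$ such that $a\in H$, $b\in U$, $a\prec b$ imply $b\in H$. For $i\in I$ let $\mathrm{fos}(i)=\{k\in K: k\not\sim i\}\cup\{i'\in I: N(i')\not\subseteq N(i)\}$ and $\mathrm{ufs}(i)=V\setminus(\mathrm{fos}(i)\cup\{i\})$. If $S$ is a maximum-weight filter of $(V,\prec)$ and, for each $i\in I$, $T_i$ is a maximum-weight filter of $(\mathrm{ufs}(i),\prec)$, then any set of maximum weight among $S$ and the sets $\mathrm{fos}(i)\cup T_i$ $(i\in I)$ is a maximum-weight feasible set of $G$. (3) Each of these closure problems reduces to a maximum flow problem (Picard). For $U=V$ or $U=\mathrm{ufs}(i)$ with $i\in I$, consider the network with node set $V\cup\{s,t\}$ and with arcs $s\to v$ of capacity $\max(w(v),0)$ and $v\to t$ of capacity $\max(-w(v),0)$ for $v\in U$, and arcs $u\to v$ of infinite capacity for $u,v\in U$ with $u\prec v$. If $f$ is a maximum $s$–$t$ flow in this network, then the set of all $v\in V$ that are reachable from $s$ in the residual network of $f$ is a maximum-weight filter of $(U,\prec)$. -/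

import Mathlib

namespace SplitShelling

/-! ### Weighted set systems -/

section SetSystems

variable {V : Type*}

/-- The weight `w(F) = ∑_{f ∈ F} w(f)` of a finite set. -/
def weight (w : V → ℝ) (F : Finset V) : ℝ := ∑ v ∈ F, w v

/-- `F` is a member of the set system `𝓕` of maximum weight. -/
def IsMaxWeight (𝓕 : Set (Finset V)) (w : V → ℝ) (F : Finset V) : Prop :=
  F ∈ 𝓕 ∧ ∀ F' ∈ 𝓕, weight w F' ≤ weight w F

end SetSystems

/-! ### Split graphs and shellings -/

section Graphs

variable {V : Type*}

/-- The vertex set of `G` is the disjoint union of the clique `K` and the independent set `I`. -/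
structure IsSplitPartition (G : SimpleGraph V) (K I : Set V) : Prop where
  disjoint : Disjoint K I
  cover : K ∪ I = Set.univ
  clique : G.IsClique K
  indep : G.IsIndepSet I

/-- A split graph: its vertices can be partitioned into a clique and an independent set. -/
def IsSplit (G : SimpleGraph V) : Prop := ∃ K I : Set V, IsSplitPartition G K I

/-- The vertex `v` is simplicial in the graph obtained from `G` by deleting the vertices in `S`:
`v` has not been deleted, and its remaining neighbours form a clique. -/
def IsSimplicialOff (G : SimpleGraph V) (S : Set V) (v : V) : Prop :=
  v ∉ S ∧ G.IsClique (G.neighborSet v \ S)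

/-- The family of feasible sets of the vertex shelling antimatroid of `G`: `F` is feasible when
its elements can be ordered as `f₁, …, f_m` (without repetition) in such a way that each `f_j` is
simplicial in `G ∖ {f₁, …, f_{j-1}}`. -/
def feasibleSets (G : SimpleGraph V) : Set (Finset V) :=
  {F | ∃ l : List V, l.Nodup ∧ (∀ v, v ∈ F ↔ v ∈ l) ∧
    ∀ (j : ℕ) (hj : j < l.length), IsSimplicialOff G {x | x ∈ l.take j} l[j]}

end Graphs

/-! ### The posets attached to a split graph, and maximum closures -/

section Closure

variable {V : Type*}

/-- The strict order `≺` of a split graph: `u ≺ v` iff `u ∈ K`, `v ∈ I` and `u ∼ v`. -/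
def prec (G : SimpleGraph V) (K I : Set V) (u v : V) : Prop := u ∈ K ∧ v ∈ I ∧ G.Adj u v

/-- The filters (up-sets) of the set `U` ordered by the restriction of the strict order `r`. -/
def filters (r : V → V → Prop) (U : Finset V) : Set (Finset V) :=
  {H | H ⊆ U ∧ ∀ a ∈ H, ∀ b ∈ U, r a b → b ∈ H}

open Classical in
/-- The forced set `fos(i) = {k ∈ K : k ≁ i} ∪ {i' ∈ I : N(i') ⊄ N(i)}`. -/
noncomputable def fos [Fintype V] (G : SimpleGraph V) (K I : Set V) (i : V) : Finset V :=
  Finset.univ.filter fun v =>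
    (v ∈ K ∧ ¬ G.Adj v i) ∨ (v ∈ I ∧ ¬ G.neighborSet v ⊆ G.neighborSet i)

open Classical in
/-- The unforced set `ufs(i)`: the complement of `fos(i)`, minus `i`. -/
noncomputable def ufs [Fintype V] (G : SimpleGraph V) (K I : Set V) (i : V) : Finset V :=
  Finset.univ.filter fun v => v ∉ fos G K I i ∧ v ≠ i

end Closure

/-! ### Flows and Picard's network -/

section Flows

open scoped NNReal ENNReal

/-- `f` is a flow from `s` to `t` in the network with node set `N` and capacities `c`. -/
structure IsFlow {N : Type*} [Fintype N] (c : N → N → ℝ≥0∞) (s t : N) (f : N → N → ℝ≥0) :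
    Prop where
  capacity : ∀ a b, (f a b : ℝ≥0∞) ≤ c a b
  conservation : ∀ a, a ≠ s → a ≠ t → ∑ b, f b a = ∑ b, f a b

/-- The value of a flow: the net amount that leaves the source. -/
def flowValue {N : Type*} [Fintype N] (s : N) (f : N → N → ℝ≥0) : ℝ :=
  (∑ b, (f s b : ℝ)) - ∑ b, (f b s : ℝ)

/-- `f` is a maximum flow from `s` to `t`. -/
def IsMaxFlow {N : Type*} [Fintype N] (c : N → N → ℝ≥0∞) (s t : N) (f : N → N → ℝ≥0) : Prop :=
  IsFlow c s t f ∧ ∀ g, IsFlow c s t g → flowValue s g ≤ flowValue s f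

/-- `b` is reachable from `a` in the residual network of the flow `f`. -/
def ResidualReach {N : Type*} (c : N → N → ℝ≥0∞) (f : N → N → ℝ≥0) (a b : N) : Prop :=
  Relation.ReflTransGen (fun x y => (f x y : ℝ≥0∞) < c x y ∨ 0 < f y x) a b

variable {V : Type*}

/-- The nodes of Picard's network: the elements of `V`, a source and a sink. -/
abbrev Node (V : Type*) := V ⊕ Bool

/-- The source. -/
abbrev source : Node V := Sum.inr true

/-- The sink. -/
abbrev sink : Node V := Sum.inr false

open Classical in
/-- Picard's capacities for the maximum closure problem on `(U, r)` with weights `w`: an arc of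
capacity `w(v)` from the source to each `v` of positive weight, an arc of capacity `-w(v)` from
each `v` of negative weight to the sink, and an arc of infinite capacity from `u` to `v` whenever
`r u v`. -/
noncomputable def picard (r : V → V → Prop) (U : Finset V) (w : V → ℝ) :
    Node V → Node V → ℝ≥0∞
  | Sum.inr true, Sum.inl v => if v ∈ U then ENNReal.ofReal (w v) else 0
  | Sum.inl v, Sum.inr false => if v ∈ U then ENNReal.ofReal (-w v) else 0
  | Sum.inl u, Sum.inl v => if u ∈ U ∧ v ∈ U ∧ r u v then ⊤ else 0
  | _, _ => 0

open Classical in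
/-- The set of elements of `V` reachable from the source in the residual network of `f`. -/
noncomputable def sourceSide [Fintype V] (r : V → V → Prop) (U : Finset V) (w : V → ℝ)
    (f : Node V → Node V → ℝ≥0) : Finset V :=
  Finset.univ.filter fun v => ResidualReach (picard r U w) f source (Sum.inl v)

end Flows

/-! ### A random access machine with real weights

The machine has finitely many named, unbounded, indirectly addressed arrays of natural numbers and
finitely many of real numbers (a scalar variable is a cell of an array). Natural numbers can be
added and subtracted; real numbers can only be copied, added, subtracted and compared. There is
no multiplication of either kind, no rounding, and no real constant except `0`. Every operation
takes one unit of time. -/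

section Machine

/-- A memory: `nat a j` and `wt a j` are the cells with index `j` of the `a`-th array of natural
numbers and of the `a`-th array of real numbers. -/
structure Memory where
  nat : ℕ → ℕ → ℕ
  wt : ℕ → ℕ → ℝ

/-- Write `x` into cell `j` of the `a`-th array of natural numbers. -/
def Memory.setNat (σ : Memory) (a j x : ℕ) : Memory :=
  { σ with nat := Function.update σ.nat a (Function.update (σ.nat a) j x) }

/-- Write `x` into cell `j` of the `a`-th array of real numbers. -/
noncomputable def Memory.setWt (σ : Memory) (a j : ℕ) (x : ℝ) : Memory :=
  { σ with wt := Function.update σ.wt a (Function.update (σ.wt a) j x) }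

/-- Expressions of natural-number type. -/
inductive NExp : Type
  | const (c : ℕ)
  | cell (a : ℕ) (j : NExp)
  | plus (e₁ e₂ : NExp)
  | minus (e₁ e₂ : NExp)

/-- The value of an expression; the subtraction is truncated at `0`. -/
def NExp.eval (σ : Memory) : NExp → ℕ
  | const c => c
  | cell a j => σ.nat a (j.eval σ)
  | plus e₁ e₂ => e₁.eval σ + e₂.eval σ
  | minus e₁ e₂ => e₁.eval σ - e₂.eval σ

/-- The number of operations performed when the expression is evaluated. -/
def NExp.cost : NExp → ℕ
  | const _ => 1
  | cell _ j => j.cost + 1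
  | plus e₁ e₂ => e₁.cost + e₂.cost + 1
  | minus e₁ e₂ => e₁.cost + e₂.cost + 1

/-- Expressions of real type. -/
inductive WExp : Type
  | zero
  | cell (a : ℕ) (j : NExp)
  | plus (e₁ e₂ : WExp)
  | minus (e₁ e₂ : WExp)

/-- The value of an expression of real type. -/
noncomputable def WExp.eval (σ : Memory) : WExp → ℝ
  | zero => 0
  | cell a j => σ.wt a (j.eval σ)
  | plus e₁ e₂ => e₁.eval σ + e₂.eval σ
  | minus e₁ e₂ => e₁.eval σ - e₂.eval σ

/-- The number of operations performed when the expression is evaluated. -/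
def WExp.cost : WExp → ℕ
  | zero => 1
  | cell _ j => j.cost + 1
  | plus e₁ e₂ => e₁.cost + e₂.cost + 1
  | minus e₁ e₂ => e₁.cost + e₂.cost + 1

/-- Tests. -/
inductive Test : Type
  | natLt (e₁ e₂ : NExp)
  | wtLt (e₁ e₂ : WExp)
  | neg (b : Test)
  | both (b₁ b₂ : Test)

/-- The test succeeds in the memory `σ`. -/
def Test.Holds (σ : Memory) : Test → Prop
  | natLt e₁ e₂ => e₁.eval σ < e₂.eval σ
  | wtLt e₁ e₂ => e₁.eval σ < e₂.eval σ
  | neg b => ¬ b.Holds σ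
  | both b₁ b₂ => b₁.Holds σ ∧ b₂.Holds σ

/-- The number of operations performed when the test is evaluated. -/
def Test.cost : Test → ℕ
  | natLt e₁ e₂ => e₁.cost + e₂.cost + 1
  | wtLt e₁ e₂ => e₁.cost + e₂.cost + 1
  | neg b => b.cost + 1
  | both b₁ b₂ => b₁.cost + b₂.cost + 1

/-- Programs. -/
inductive Prog : Type
  | skip
  | setNat (a : ℕ) (j e : NExp)
  | setWt (a : ℕ) (j : NExp) (e : WExp)
  | seq (p q : Prog)
  | ite (b : Test) (p q : Prog)
  | loop (b : Test) (p : Prog)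

/-- `Runs p σ t τ`: the program `p`, started in the memory `σ`, halts after exactly `t` steps with
the memory `τ`. Here `loop b p` is "while `b` do `p`". -/
inductive Runs : Prog → Memory → ℕ → Memory → Prop
  | skip (σ : Memory) : Runs .skip σ 1 σ
  | setNat (a : ℕ) (j e : NExp) (σ : Memory) :
      Runs (.setNat a j e) σ (j.cost + e.cost + 1) (σ.setNat a (j.eval σ) (e.eval σ))
  | setWt (a : ℕ) (j : NExp) (e : WExp) (σ : Memory) :
      Runs (.setWt a j e) σ (j.cost + e.cost + 1) (σ.setWt a (j.eval σ) (e.eval σ))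
  | seq {p q : Prog} {σ τ υ : Memory} {s t : ℕ} (hp : Runs p σ s τ) (hq : Runs q τ t υ) :
      Runs (.seq p q) σ (s + t) υ
  | ite_pos {b : Test} {p q : Prog} {σ τ : Memory} {t : ℕ} (hb : b.Holds σ) (hp : Runs p σ t τ) :
      Runs (.ite b p q) σ (b.cost + t + 1) τ
  | ite_neg {b : Test} {p q : Prog} {σ τ : Memory} {t : ℕ} (hb : ¬ b.Holds σ)
      (hq : Runs q σ t τ) : Runs (.ite b p q) σ (b.cost + t + 1) τ
  | loop_done {b : Test} {p : Prog} {σ : Memory} (hb : ¬ b.Holds σ) :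
      Runs (.loop b p) σ (b.cost + 1) σ
  | loop_step {b : Test} {p : Prog} {σ τ υ : Memory} {s t : ℕ} (hb : b.Holds σ)
      (hp : Runs p σ s τ) (hl : Runs (.loop b p) τ t υ) :
      Runs (.loop b p) σ (b.cost + s + t + 1) υ

end Machine

/-! ### Input and output -/

section Coding

/-- The list `es` is a list of the edges of `G`: each edge is listed as a pair of end vertices,
in one or the other order (a repetition only makes the input longer). -/
def IsEdgeList {n : ℕ} (G : SimpleGraph (Fin n)) (es : List (Fin n × Fin n)) : Prop :=
  ∀ u v, G.Adj u v ↔ (u, v) ∈ es ∨ (v, u) ∈ es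

/-- The initial memory for the weighted graph with vertices `0, …, n - 1`, list of edges `es` and
weights `w`: array `0` of natural numbers holds the number of vertices and the length of the list
of edges, arrays `1` and `2` hold the first and the second ends of the listed edges, and array `0`
of real numbers holds the weights. All other cells are `0`. The partition of a split graph into
a clique and an independent set is not part of the input. -/
noncomputable def input (n : ℕ) (es : List (Fin n × Fin n)) (w : Fin n → ℝ) : Memory where
  nat := fun a j =>
    match a with
    | 0 => if j = 0 then n else if j = 1 then es.length else 0
    | 1 => if h : j < es.length then (es[j].1 : ℕ) else 0
    | 2 => if h : j < es.length then (es[j].2 : ℕ) else 0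
    | _ => 0
  wt := fun a j => if h : a = 0 ∧ j < n then w ⟨j, h.2⟩ else 0

/-- The set of vertices that a final memory represents: those `v` for which cell `v` of array `3`
of natural numbers contains `1`. -/
def output (n : ℕ) (σ : Memory) : Finset (Fin n) :=
  Finset.univ.filter fun v => σ.nat 3 v = 1

end Coding

end SplitShelling

namespace SplitShelling

/-! ### Programs built from bounded loops -/

section LoopPrograms

/-! Graph theory. Let $F$ be feasible. If no clique vertex of $F$ has an independent neighbour
outside $F$, then $F$ is a filter. Otherwise take the first vertex $f_j\in K$ of the shelling with
an independent neighbour $i\notin F$. The vertex $i$ is never removed, so every clique vertex not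
adjacent to $i$ must precede $f_j$; by minimality of $j$, the independent neighbours of those
vertices lie in $F$. Hence $\mathrm{fos}(i)\subseteq F$, and the rest of $F$ is a filter of
$\mathrm{ufs}(i)$. Conversely, such sets are shelled by removing independent vertices before clique
vertices. This is `feasible_cases`, with `filter_feasible` and `fos_union_feasible` for the
converse; since $w(\mathrm{fos}(i))$ is constant, the decomposition follows.

Closures. Both the reduction to flows and the algorithm rest on one duality statement,
`isMaxWeight_filters_of_slackness`: a nonnegative flow on the arcs of the order, with excess
$e=w+\text{inflow}-\text{outflow}$, certifies that a filter is optimal if $e\ge 0$ on it, $e\le 0$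
off it and no flow enters it. A maximum flow in Picard's network has no augmenting path, and its
residual source side satisfies these conditions.

Algorithm. The machine computes a split partition by simpliciality tests and solves each closure
problem by push-relabel, starting from the zero flow with excess $w$, so that no source or sink is
stored. When no vertex is active, a label $l\le n+1$ that does not occur exists by pigeonhole, and
the vertices of label above $l$ form the optimal filter (`PState.Inv.isMaxWeight_filter`). An
integer measure below $(n+1)^6$ drops in every round that finds an active vertex, so $(n+1)^6$
rounds suffice.

Programs. The algorithm is written with bounded loops only, whose bounds come from a read-only
array. Such programs denote total functions on memories, and their polynomial running time follows
from their syntax (`runs_compile`, `time_le_polynomial`); correctness is then proved about these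
functions by loop invariants. -/

@[simp] theorem Memory.setNat_nat (σ : Memory) (a j x b i : ℕ) :
    (σ.setNat a j x).nat b i = if b = a ∧ i = j then x else σ.nat b i := by
  unfold Memory.setNat
  by_cases hb : b = a
  · subst hb
    by_cases hi : i = j
    · subst hi; simp
    · simp [hi]
  · simp [hb]

@[simp] theorem Memory.setNat_wt (σ : Memory) (a j x : ℕ) : (σ.setNat a j x).wt = σ.wt := rfl

@[simp] theorem Memory.setWt_nat (σ : Memory) (a j : ℕ) (x : ℝ) :
    (σ.setWt a j x).nat = σ.nat := rfl

@[simp] theorem Memory.setWt_wt (σ : Memory) (a j : ℕ) (x : ℝ) (b i : ℕ) :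
    (σ.setWt a j x).wt b i = if b = a ∧ i = j then x else σ.wt b i := by
  unfold Memory.setWt
  by_cases hb : b = a
  · subst hb
    by_cases hi : i = j
    · subst hi; simp
    · simp [hi]
  · simp [hb]

theorem Memory.setNat_nat_ne (σ : Memory) {a b : ℕ} (j x : ℕ) (h : b ≠ a) :
    (σ.setNat a j x).nat b = σ.nat b := by
  funext i; simp [h]

theorem Memory.setWt_wt_ne (σ : Memory) {a b : ℕ} (j : ℕ) (x : ℝ) (h : b ≠ a) :
    (σ.setWt a j x).wt b = σ.wt b := by
  funext i; simp [h]

/-- Programs whose only loops are of the form "for `v` from `0` below `nat 0 b + k` do `p`", where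
the loop variable is the cell with index `0` of the `v`-th array of natural numbers. -/
inductive LProg : Type
  | skip
  | setNat (a : ℕ) (j e : NExp)
  | setWt (a : ℕ) (j : NExp) (e : WExp)
  | seq (p q : LProg)
  | ite (b : Test) (p q : LProg)
  | for_ (v b k : ℕ) (p : LProg)

namespace LProg

/-- The test of a bounded loop. -/
def guard (v b k : ℕ) : Test :=
  .natLt (.cell v (.const 0)) (.plus (.cell 0 (.const b)) (.const k))

/-- The translation into a while-program. -/
def compile : LProg → Prog
  | skip => .skip
  | setNat a j e => .setNat a j e
  | setWt a j e => .setWt a j e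
  | seq p q => .seq p.compile q.compile
  | ite b p q => .ite b p.compile q.compile
  | for_ v b k p =>
      .seq (.setNat v (.const 0) (.const 0))
        (.loop (guard v b k)
          (.seq p.compile (.setNat v (.const 0) (.plus (.cell v (.const 0)) (.const 1)))))

/-- The memory after `k` rounds of a bounded loop with loop variable `v`. -/
def iter (f : Memory → Memory) (v : ℕ) (σ : Memory) : ℕ → Memory
  | 0 => σ.setNat v 0 0
  | k + 1 => (f (iter f v σ k)).setNat v 0 ((f (iter f v σ k)).nat v 0 + 1)

open Classical in
/-- The memory transformation that a program performs. -/
noncomputable def den : LProg → Memory → Memory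
  | skip, σ => σ
  | setNat a j e, σ => σ.setNat a (j.eval σ) (e.eval σ)
  | setWt a j e, σ => σ.setWt a (j.eval σ) (e.eval σ)
  | seq p q, σ => q.den (p.den σ)
  | ite b p q, σ => if b.Holds σ then p.den σ else q.den σ
  | for_ v b k p, σ => iter p.den v σ (σ.nat 0 b + k)

theorem den_seq (p q : LProg) (σ : Memory) : (seq p q).den σ = q.den (p.den σ) := rfl

/-- The arrays of natural numbers that a program may write to. -/
def natWrites : LProg → List ℕ
  | skip => []
  | setNat a _ _ => [a]
  | setWt _ _ _ => []
  | seq p q => p.natWrites ++ q.natWrites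
  | ite _ p q => p.natWrites ++ q.natWrites
  | for_ v _ _ p => v :: p.natWrites

/-- The arrays of real numbers that a program may write to. -/
def wtWrites : LProg → List ℕ
  | skip => []
  | setNat _ _ _ => []
  | setWt a _ _ => [a]
  | seq p q => p.wtWrites ++ q.wtWrites
  | ite _ p q => p.wtWrites ++ q.wtWrites
  | for_ _ _ _ p => p.wtWrites

/-- No loop variable is written to in the body of its loop. -/
def WF : LProg → Bool
  | skip => true
  | setNat _ _ _ => true
  | setWt _ _ _ => true
  | seq p q => p.WF && q.WF
  | ite _ p q => p.WF && q.WF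
  | for_ v _ _ p => p.WF && decide (v ∉ p.natWrites)

/-- A bound for the running time, in terms of array `0` of natural numbers. -/
def time (s : ℕ → ℕ) : LProg → ℕ
  | skip => 1
  | setNat _ j e => j.cost + e.cost + 1
  | setWt _ j e => j.cost + e.cost + 1
  | seq p q => p.time s + q.time s
  | ite b p q => b.cost + (p.time s + q.time s) + 1
  | for_ _ b k p => 12 + (s b + k) * (p.time s + 20)

/-! ### Frame properties: arrays that a program leaves untouched -/

theorem den_nat (p : LProg) (σ : Memory) {a : ℕ} (ha : a ∉ p.natWrites) :
    (p.den σ).nat a = σ.nat a := by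
  induction p generalizing σ with
  | skip => rfl
  | setNat b j e =>
    simp only [natWrites, List.mem_singleton] at ha
    exact Memory.setNat_nat_ne _ _ _ ha
  | setWt b j e => rfl
  | seq p q hp hq =>
    simp only [natWrites, List.mem_append, not_or] at ha
    simp only [den]
    rw [hq _ ha.2, hp _ ha.1]
  | ite b p q hp hq =>
    simp only [natWrites, List.mem_append, not_or] at ha
    simp only [den]
    split_ifs
    · exact hp _ ha.1
    · exact hq _ ha.2
  | for_ v b k p hp =>
    simp only [natWrites, List.mem_cons, not_or] at ha
    simp only [den]
    induction σ.nat 0 b + k with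
    | zero => exact Memory.setNat_nat_ne _ _ _ ha.1
    | succ m ih =>
      rw [iter, Memory.setNat_nat_ne _ _ _ ha.1, hp _ ha.2, ih]

theorem den_wt (p : LProg) (σ : Memory) {a : ℕ} (ha : a ∉ p.wtWrites) :
    (p.den σ).wt a = σ.wt a := by
  induction p generalizing σ with
  | skip => rfl
  | setNat b j e => rfl
  | setWt b j e =>
    simp only [wtWrites, List.mem_singleton] at ha
    exact Memory.setWt_wt_ne _ _ _ ha
  | seq p q hp hq =>
    simp only [wtWrites, List.mem_append, not_or] at ha
    simp only [den]
    rw [hq _ ha.2, hp _ ha.1]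
  | ite b p q hp hq =>
    simp only [wtWrites, List.mem_append, not_or] at ha
    simp only [den]
    split_ifs
    · exact hp _ ha.1
    · exact hq _ ha.2
  | for_ v b k p hp =>
    simp only [wtWrites] at ha
    simp only [den]
    induction σ.nat 0 b + k with
    | zero => rfl
    | succ m ih =>
      rw [iter, Memory.setNat_wt, hp _ ha, ih]

/-- `τ` agrees with `σ` on all arrays that `p` does not write to. -/
structure Frame (p : LProg) (σ τ : Memory) : Prop where
  nat : ∀ a, a ∉ p.natWrites → τ.nat a = σ.nat a
  wt : ∀ a, a ∉ p.wtWrites → τ.wt a = σ.wt a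

theorem frame (p : LProg) (σ : Memory) : Frame p σ (p.den σ) :=
  ⟨fun _ => p.den_nat σ, fun _ => p.den_wt σ⟩

theorem iter_frame {v b k : ℕ} {p : LProg} (σ : Memory) (m : ℕ) :
    Frame (for_ v b k p) σ (iter p.den v σ m) := by
  induction m with
  | zero =>
    refine ⟨fun a ha => ?_, fun a _ => rfl⟩
    simp only [natWrites, List.mem_cons, not_or] at ha
    exact Memory.setNat_nat_ne _ _ _ ha.1
  | succ m ih =>
    refine ⟨fun a ha => ?_, fun a ha => ?_⟩
    · rw [← ih.nat a ha]
      simp only [natWrites, List.mem_cons, not_or] at ha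
      rw [iter, Memory.setNat_nat_ne _ _ _ ha.1, p.den_nat _ ha.2]
    · rw [← ih.wt a ha]
      rw [iter, Memory.setNat_wt, p.den_wt _ ha]

theorem iter_var {v : ℕ} {p : LProg} (hv : v ∉ p.natWrites) (σ : Memory) (m : ℕ) :
    (iter p.den v σ m).nat v 0 = m := by
  induction m with
  | zero => simp [iter]
  | succ m ih => simp [iter, p.den_nat _ hv, ih]

/-- The invariant rule for bounded loops. -/
theorem for_induction {v b k : ℕ} {p : LProg} {σ : Memory} (J : ℕ → Memory → Prop)
    (hv : v ∉ p.natWrites) (h0 : J 0 (σ.setNat v 0 0))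
    (hs : ∀ i < σ.nat 0 b + k, ∀ τ, τ.nat v 0 = i → Frame (for_ v b k p) σ τ → J i τ →
      J (i + 1) ((p.den τ).setNat v 0 (i + 1))) :
    J (σ.nat 0 b + k) ((for_ v b k p).den σ) := by
  have key : ∀ m ≤ σ.nat 0 b + k, J m (iter p.den v σ m) := by
    intro m
    induction m with
    | zero => intro _; exact h0
    | succ m ih =>
      intro hm
      have := hs m (by omega) _ (iter_var hv σ m) (iter_frame σ m) (ih (by omega))
      rw [iter, p.den_nat _ hv, iter_var hv]
      exact this
  exact key _ le_rfl

/-! ### Running times of compiled programs -/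

theorem runs_loop {v b k : ℕ} {p : LProg} (hv : v ∉ p.natWrites) (h0 : v ≠ 0)
    (h0p : 0 ∉ p.natWrites) {T : ℕ} (σ : Memory)
    (hp : ∀ τ : Memory, τ.nat 0 = σ.nat 0 → ∃ t ≤ T, Runs p.compile τ t (p.den τ)) (d : ℕ) :
    ∀ m, m + d = σ.nat 0 b + k → ∃ t ≤ 8 + d * (T + 20),
      Runs (.loop (guard v b k)
        (.seq p.compile (.setNat v (.const 0) (.plus (.cell v (.const 0)) (.const 1)))))
        (iter p.den v σ m) t (iter p.den v σ (m + d)) := by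
  have h0W : 0 ∉ (for_ v b k p).natWrites := by
    simp [natWrites, h0p, h0.symm]
  -- The while-loop evaluates its bound anew in every round; as array `0` is not written to, it
  -- always finds the initial value.
  have hg : ∀ m, (guard v b k).Holds (iter p.den v σ m) ↔ m < σ.nat 0 b + k := by
    intro m
    simp only [guard, Test.Holds, NExp.eval, iter_var hv]
    rw [(iter_frame (v := v) (b := b) (k := k) σ m).nat 0 h0W]
  induction d with
  | zero =>
    intro m hm
    refine ⟨_, ?_, Runs.loop_done ?_⟩
    · simp [guard, Test.cost, NExp.cost]
    · rw [hg]; omega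
  | succ d ih =>
    intro m hm
    obtain ⟨t, ht, hr⟩ := ih (m + 1) (by omega)
    obtain ⟨s, hs, hr'⟩ := hp (iter p.den v σ m)
      ((iter_frame (v := v) (b := b) (k := k) σ m).nat 0 h0W)
    have hset := Runs.setNat v (.const 0) (.plus (.cell v (.const 0)) (.const 1))
      (p.den (iter p.den v σ m))
    have := Runs.loop_step (b := guard v b k) (by rw [hg]; omega) (Runs.seq hr' hset) hr
    refine ⟨_, ?_, by rw [show m + (d + 1) = m + 1 + d by omega]; exact this⟩
    -- A round costs 7 for the guard, 6 for the increment, 1 for the loop and at most `T` for the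
    -- body; the constant 20 leaves room.
    simp only [guard, Test.cost, NExp.cost]
    have : (d + 1) * (T + 20) = d * (T + 20) + T + 20 := by ring
    omega

/-- This links the functional semantics to the machine. Both hypotheses are decidable properties of
the program text and are discharged by evaluation for the final program. -/
theorem runs_compile (p : LProg) (hwf : p.WF) (h0 : 0 ∉ p.natWrites) (σ : Memory) :
    ∃ t ≤ p.time (σ.nat 0), Runs p.compile σ t (p.den σ) := by
  induction p generalizing σ with
  | skip => exact ⟨_, le_rfl, Runs.skip σ⟩
  | setNat a j e => exact ⟨_, le_rfl, Runs.setNat a j e σ⟩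
  | setWt a j e => exact ⟨_, le_rfl, Runs.setWt a j e σ⟩
  | seq p q hp hq =>
    simp only [natWrites, List.mem_append, not_or] at h0
    simp only [WF, Bool.and_eq_true] at hwf
    obtain ⟨t, ht, hr⟩ := hp hwf.1 h0.1 σ
    obtain ⟨s, hs, hr'⟩ := hq hwf.2 h0.2 (p.den σ)
    rw [p.den_nat σ h0.1] at hs
    exact ⟨_, Nat.add_le_add ht hs, Runs.seq hr hr'⟩
  | ite b p q hp hq =>
    simp only [natWrites, List.mem_append, not_or] at h0
    simp only [WF, Bool.and_eq_true] at hwf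
    obtain ⟨t, ht, hr⟩ := hp hwf.1 h0.1 σ
    obtain ⟨s, hs, hr'⟩ := hq hwf.2 h0.2 σ
    simp only [den, time]
    by_cases hb : b.Holds σ
    · rw [if_pos hb]
      exact ⟨_, by omega, Runs.ite_pos hb hr⟩
    · rw [if_neg hb]
      exact ⟨_, by omega, Runs.ite_neg hb hr'⟩
  | for_ v b k p hp =>
    simp only [natWrites, List.mem_cons, not_or] at h0
    simp only [WF, Bool.and_eq_true, decide_eq_true_eq] at hwf
    obtain ⟨t, ht, hr⟩ := runs_loop (b := b) (k := k) (T := p.time (σ.nat 0)) hwf.2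
      (Ne.symm h0.1) h0.2 σ
      (fun τ hτ => by have := hp hwf.1 h0.2 τ; rwa [hτ] at this) (σ.nat 0 b + k) 0 (by omega)
    refine ⟨_, ?_, Runs.seq (Runs.setNat v (.const 0) (.const 0) σ) (by rw [Nat.zero_add] at hr; exact hr)⟩
    simp only [time, NExp.cost]
    omega

/-- Each loop multiplies the bound by a linear factor, and the nesting depth is fixed by the
program. -/
theorem time_le_polynomial (p : LProg) :
    ∃ q : Polynomial ℕ, ∀ (s : ℕ → ℕ) (B : ℕ), (∀ j, s j ≤ B) → p.time s ≤ q.eval B := by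
  induction p with
  | skip => exact ⟨1, fun s B _ => by simp [time]⟩
  | setNat a j e => exact ⟨Polynomial.C (j.cost + e.cost + 1), fun s B _ => by
      rw [Polynomial.eval_C]; rfl⟩
  | setWt a j e => exact ⟨Polynomial.C (j.cost + e.cost + 1), fun s B _ => by
      rw [Polynomial.eval_C]; rfl⟩
  | seq p q hp hq =>
    obtain ⟨p', hp⟩ := hp
    obtain ⟨q', hq⟩ := hq
    exact ⟨p' + q', fun s B h => by
      rw [Polynomial.eval_add]; exact Nat.add_le_add (hp s B h) (hq s B h)⟩
  | ite b p q hp hq =>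
    obtain ⟨p', hp⟩ := hp
    obtain ⟨q', hq⟩ := hq
    refine ⟨Polynomial.C (b.cost + 1) + (p' + q'), fun s B h => ?_⟩
    have := hp s B h
    have := hq s B h
    simp only [Polynomial.eval_add, Polynomial.eval_C, time]
    omega
  | for_ v b k p hp =>
    obtain ⟨p', hp⟩ := hp
    refine ⟨Polynomial.C 12 + (Polynomial.X + Polynomial.C k) * (p' + Polynomial.C 20),
      fun s B h => ?_⟩
    have := hp s B h
    have := h b
    simp only [Polynomial.eval_add, Polynomial.eval_C, Polynomial.eval_mul, Polynomial.eval_X,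
      time]
    gcongr

end LProg

end LoopPrograms

/-! ### The feasible sets of a split graph -/

section FeasibleSets

variable {V : Type*}

theorem IsSplitPartition.mem_or {G : SimpleGraph V} {K I : Set V} (h : IsSplitPartition G K I)
    (v : V) : v ∈ K ∨ v ∈ I := by
  have : v ∈ K ∪ I := by rw [h.cover]; trivial
  exact this

theorem IsSplitPartition.not_mem_right {G : SimpleGraph V} {K I : Set V}
    (h : IsSplitPartition G K I) {v : V} (hv : v ∈ K) : v ∉ I :=
  Set.disjoint_left.1 h.disjoint hv

theorem IsSplitPartition.not_adj {G : SimpleGraph V} {K I : Set V}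
    (h : IsSplitPartition G K I) {u v : V} (hu : u ∈ I) (hv : v ∈ I) : ¬ G.Adj u v :=
  fun huv => h.indep hu hv huv.ne huv

theorem IsSplitPartition.adj {G : SimpleGraph V} {K I : Set V}
    (h : IsSplitPartition G K I) {u v : V} (hu : u ∈ K) (hv : v ∈ K) (huv : u ≠ v) : G.Adj u v :=
  h.clique hu hv huv

theorem isSimplicialOff_iff {G : SimpleGraph V} {S : Set V} {v : V} :
    IsSimplicialOff G S v ↔ v ∉ S ∧ ∀ a b, G.Adj v a → a ∉ S → G.Adj v b → b ∉ S → a ≠ b →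
      G.Adj a b := by
  constructor
  · rintro ⟨h, hc⟩
    exact ⟨h, fun a b ha ha' hb hb' hab => hc ⟨ha, ha'⟩ ⟨hb, hb'⟩ hab⟩
  · rintro ⟨h, hc⟩
    exact ⟨h, fun a ha b hb hab => hc a b ha.1 ha.2 hb.1 hb.2 hab⟩

/-- Deleting further vertices only shrinks the remaining neighbourhood, so simplicial vertices may
be removed in any later order. -/
theorem IsSimplicialOff.mono {G : SimpleGraph V} {S T : Set V} {v : V}
    (h : IsSimplicialOff G S v) (hST : S ⊆ T) (hv : v ∉ T) : IsSimplicialOff G T v :=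
  ⟨hv, fun _ ha _ hb => h.2 ⟨ha.1, fun hs => ha.2 (hST hs)⟩ ⟨hb.1, fun hs => hb.2 (hST hs)⟩⟩

/-- A feasible set can be enlarged by vertices that are simplicial after its removal. -/
theorem feasibleSets_union [DecidableEq V] {G : SimpleGraph V} {F : Finset V}
    (hF : F ∈ feasibleSets G) (A : Finset V)
    (hA : ∀ v ∈ A, v ∉ F → IsSimplicialOff G (F : Set V) v) : F ∪ A ∈ feasibleSets G := by
  induction A using Finset.induction_on with
  | empty => simpa using hF
  | insert v A hvA ih =>
    have ih := ih fun u hu => hA u (Finset.mem_insert_of_mem hu)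
    by_cases hv : v ∈ F ∪ A
    · rwa [Finset.union_insert, Finset.insert_eq_of_mem hv]
    · obtain ⟨l, hnd, hl, hs⟩ := ih
      have hvl : v ∉ l := fun h => hv ((hl v).2 h)
      refine ⟨l ++ [v], ?_, ?_, ?_⟩
      · rw [List.nodup_append]
        refine ⟨hnd, List.nodup_singleton v, ?_⟩
        rintro a ha b hb rfl
        rw [List.mem_singleton] at hb
        exact hvl (hb ▸ ha)
      · intro u
        rw [Finset.union_insert, Finset.mem_insert, hl, List.mem_append, List.mem_singleton]
        tauto
      · intro j hj
        rw [List.length_append, List.length_singleton] at hj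
        rcases Nat.lt_or_ge j l.length with hjl | hjl
        · rw [List.getElem_append_left hjl, List.take_append_of_le_length hjl.le]
          exact hs j hjl
        · obtain rfl : j = l.length := by omega
          rw [List.take_left, List.getElem_concat_length rfl]
          -- By assumption `v` is simplicial off `F`; the list enumerates `F ∪ A`, which is larger,
          -- so monotonicity applies.
          refine (hA v (Finset.mem_insert_self v A) fun h => hv (by simp [h])).mono ?_ hvl
          intro u hu
          exact (hl u).1 (Finset.mem_union_left _ hu)

theorem empty_mem_feasibleSets (G : SimpleGraph V) : ∅ ∈ feasibleSets G :=
  ⟨[], List.nodup_nil, by simp, by simp⟩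

theorem IsSplitPartition.isSimplicialOff_of_mem_right {G : SimpleGraph V} {K I : Set V}
    (h : IsSplitPartition G K I) {v : V} (hv : v ∈ I) {S : Set V} (hS : v ∉ S) :
    IsSimplicialOff G S v := by
  have key : ∀ a, G.Adj v a → a ∈ K := fun a ha =>
    (h.mem_or a).resolve_right fun haI => h.not_adj hv haI ha
  exact isSimplicialOff_iff.2 ⟨hS, fun a b ha _ hb _ hab => h.adj (key a ha) (key b hb) hab⟩

/-- A set is feasible if its vertices in the clique are simplicial once its vertices in the
independent set and a part of its vertices in the clique have been removed, and the vertices of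
that part are simplicial once the former have been removed. -/
theorem IsSplitPartition.feasible_of {G : SimpleGraph V} {K I : Set V}
    (h : IsSplitPartition G K I) {F A B C : Finset V} (hF : ∀ v, v ∈ F ↔ v ∈ A ∨ v ∈ B ∨ v ∈ C)
    (hA : ∀ v ∈ A, v ∈ I) (hB : ∀ v ∈ B, v ∉ A → IsSimplicialOff G (A : Set V) v)
    (hC : ∀ v ∈ C, v ∉ A → v ∉ B → IsSimplicialOff G ((A : Set V) ∪ B) v) :
    F ∈ feasibleSets G := by
  classical
  have h1 := feasibleSets_union (empty_mem_feasibleSets G) A fun v hv _ =>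
    h.isSimplicialOff_of_mem_right (hA v hv) (by simp)
  rw [Finset.empty_union] at h1
  have h2 := feasibleSets_union h1 B hB
  have h3 := feasibleSets_union h2 C fun v hv hv' => by
    rw [Finset.mem_union, not_or] at hv'
    rw [Finset.coe_union]
    exact hC v hv hv'.1 hv'.2
  convert h3 using 1
  ext v
  rw [hF, Finset.mem_union, Finset.mem_union]
  tauto

theorem weight_union [DecidableEq V] (w : V → ℝ) {A B : Finset V} (h : Disjoint A B) :
    weight w (A ∪ B) = weight w A + weight w B :=
  Finset.sum_union h

variable {G : SimpleGraph V} {K I : Set V}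

/-- The independent vertices of `H` go first. Every independent neighbour of a clique vertex of `H`
is in `H`, hence already gone, and what remains of its neighbourhood lies in `K`. -/
theorem IsSplitPartition.filter_feasible (h : IsSplitPartition G K I) {U H : Finset V}
    (hU : ∀ v, v ∈ U) (hH : H ∈ filters (prec G K I) U) : H ∈ feasibleSets G := by
  classical
  refine h.feasible_of (A := H.filter (· ∈ I)) (B := H) (C := ∅) ?_ ?_ ?_ ?_
  · simp only [Finset.mem_filter, Finset.notMem_empty]; tauto
  · intro v hv; exact (Finset.mem_filter.1 hv).2
  · intro v hv hv'
    have hvK : v ∈ K := (h.mem_or v).resolve_right fun hI => hv' (Finset.mem_filter.2 ⟨hv, hI⟩)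
    have key : ∀ a, G.Adj v a → a ∉ ((H.filter (· ∈ I) : Finset V) : Set V) → a ∈ K := by
      intro a ha ha'
      refine (h.mem_or a).resolve_right fun haI => ha' ?_
      exact Finset.mem_coe.2 (Finset.mem_filter.2 ⟨hH.2 v hv a (hU a) ⟨hvK, haI, ha⟩, haI⟩)
    exact isSimplicialOff_iff.2 ⟨hv', fun a b ha ha' hb hb' hab =>
      h.adj (key a ha ha') (key b hb hb') hab⟩
  · simp

variable [Fintype V]

theorem mem_fos {i v : V} : v ∈ fos G K I i ↔
    (v ∈ K ∧ ¬ G.Adj v i) ∨ (v ∈ I ∧ ¬ G.neighborSet v ⊆ G.neighborSet i) := by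
  simp [fos]

theorem mem_ufs {i v : V} : v ∈ ufs G K I i ↔ v ∉ fos G K I i ∧ v ≠ i := by
  simp [ufs]

theorem IsSplitPartition.not_mem_fos (h : IsSplitPartition G K I) {i : V} (hi : i ∈ I) :
    i ∉ fos G K I i := by
  rw [mem_fos]
  rintro (⟨hK, -⟩ | ⟨-, hn⟩)
  · exact h.not_mem_right hK hi
  · exact hn le_rfl

/-- The order of removal is: independent vertices, forced clique vertices, remaining clique vertices
of `T`. A surviving independent vertex `a` has `N(a) ⊆ N(i)`, so a clique vertex not adjacent to `i`
sees only clique vertices. Afterwards all surviving clique vertices are adjacent to `i`, and the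
filter property leaves `i` as the only possible independent neighbour of a vertex of `T`; so its
neighbours lie in the clique formed by `i` and `K ∩ N(i)`. -/
theorem IsSplitPartition.fos_union_feasible [DecidableEq V] (h : IsSplitPartition G K I) {i : V}
    (hi : i ∈ I) {T : Finset V} (hT : T ∈ filters (prec G K I) (ufs G K I i)) :
    fos G K I i ∪ T ∈ feasibleSets G := by
  classical
  set F := fos G K I i ∪ T with hF
  have hiF : i ∉ F := by
    rw [hF, Finset.mem_union, not_or]
    exact ⟨h.not_mem_fos hi, fun hiT => (mem_ufs.1 (hT.1 hiT)).2 rfl⟩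
  have hnbr : ∀ a ∈ I, a ∉ F → G.neighborSet a ⊆ G.neighborSet i := by
    intro a ha haF
    by_contra hcon
    exact haF (Finset.mem_union_left _ (mem_fos.2 (Or.inr ⟨ha, hcon⟩)))
  have hI : ∀ a, a ∈ I → a ∉ F.filter (· ∈ I) → a ∉ F := fun a haI ha haF =>
    ha (Finset.mem_filter.2 ⟨haF, haI⟩)
  refine h.feasible_of (A := F.filter (· ∈ I)) (B := fos G K I i) (C := T) ?_ ?_ ?_ ?_
  · simp only [Finset.mem_filter, hF, Finset.mem_union]; tauto
  · intro v hv; exact (Finset.mem_filter.1 hv).2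
  · intro v hv hv'
    have hvF : v ∈ F := Finset.mem_union_left _ hv
    have hvI : v ∉ I := fun hI => hv' (Finset.mem_filter.2 ⟨hvF, hI⟩)
    have hvi : ¬ G.Adj v i := by
      rcases mem_fos.1 hv with h1 | h1
      · exact h1.2
      · exact absurd h1.1 hvI
    have key : ∀ a, G.Adj v a → a ∉ ((F.filter (· ∈ I) : Finset V) : Set V) → a ∈ K := by
      intro a ha ha'
      refine (h.mem_or a).resolve_right fun haI => hvi ?_
      exact (hnbr a haI (hI a haI ha') ha.symm : G.Adj i v).symm
    exact isSimplicialOff_iff.2 ⟨hv', fun a b ha ha' hb hb' hab =>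
      h.adj (key a ha ha') (key b hb hb') hab⟩
  · intro v hv hv' hv''
    have hvF : v ∈ F := Finset.mem_union_right _ hv
    have hvI : v ∉ I := fun hI => hv' (Finset.mem_filter.2 ⟨hvF, hI⟩)
    have hvK : v ∈ K := (h.mem_or v).resolve_right hvI
    have key : ∀ a, G.Adj v a →
        a ∉ ((F.filter (· ∈ I) : Finset V) : Set V) ∪ (fos G K I i : Set V) →
        (a ∈ K ∧ G.Adj a i) ∨ a = i := by
      intro a ha ha'
      rw [Set.mem_union, not_or, Finset.mem_coe, Finset.mem_coe] at ha'
      rcases h.mem_or a with haK | haI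
      · left
        refine ⟨haK, ?_⟩
        by_contra hcon
        exact ha'.2 (mem_fos.2 (Or.inl ⟨haK, hcon⟩))
      · right
        by_contra hne
        refine hI a haI ha'.1 (Finset.mem_union_right _ ?_)
        exact hT.2 v hv a (mem_ufs.2 ⟨ha'.2, hne⟩) ⟨hvK, haI, ha⟩
    refine isSimplicialOff_iff.2 ⟨?_, fun a b ha ha' hb hb' hab => ?_⟩
    · rintro (hm | hm)
      · exact hv' hm
      · exact hv'' hm
    · rcases key a ha ha' with ⟨haK, hai⟩ | rfl
      · rcases key b hb hb' with ⟨hbK, -⟩ | rfl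
        · exact h.adj haK hbK hab
        · exact hai
      · rcases key b hb hb' with ⟨-, hbi⟩ | rfl
        · exact hbi.symm
        · exact absurd rfl hab

/-- A feasible set is a filter, or it consists of a forced set and of a filter in the
corresponding unforced set. -/
theorem IsSplitPartition.feasible_cases [DecidableEq V] (h : IsSplitPartition G K I)
    {F : Finset V} (hF : F ∈ feasibleSets G) :
    F ∈ filters (prec G K I) Finset.univ ∨
      ∃ i ∈ I, ∃ T ∈ filters (prec G K I) (ufs G K I i), F = fos G K I i ∪ T := by
  classical
  obtain ⟨l, hnd, hl, hs⟩ := hF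
  by_cases hex : ∃ j, ∃ hj : j < l.length, l[j] ∈ K ∧ ∃ i ∈ I, i ∉ F ∧ G.Adj l[j] i
  swap
  · left
    refine ⟨Finset.subset_univ F, fun a ha b _ hab => ?_⟩
    by_contra hb
    obtain ⟨j, hj, rfl⟩ := List.getElem_of_mem ((hl a).1 ha)
    exact hex ⟨j, hj, hab.1, b, hab.2.1, hb, hab.2.2⟩
  right
  -- The minimal position matters: before it, every removed clique vertex has all its independent
  -- neighbours in `F`.
  obtain ⟨hj, hjK, i, hiI, hiF, hadj⟩ := Nat.find_spec hex
  have hmin := fun m => Nat.find_min hex (m := m)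
  set j := Nat.find hex
  have hsj := isSimplicialOff_iff.1 (hs j hj)
  have hil : ∀ m, i ∉ l.take m := fun m hm => hiF ((hl i).2 (List.mem_of_mem_take hm))
  -- A later `k` would be, together with `i`, a nonadjacent pair of remaining neighbours of `l[j]`.
  have hK : ∀ k ∈ K, ¬ G.Adj k i → k ∈ l.take j := by
    intro k hk hki
    by_contra hcon
    have hne : l[j] ≠ k := by rintro rfl; exact hki hadj
    have hki' : k ≠ i := by rintro rfl; exact h.not_mem_right hk hiI
    exact hki (hsj.2 k i (h.adj hjK hk hne) hcon hadj (hil j) hki')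
  have hfos : fos G K I i ⊆ F := by
    intro v hv
    rcases mem_fos.1 hv with ⟨hvK, hvi⟩ | ⟨hvI, hvn⟩
    · exact (hl v).2 (List.mem_of_mem_take (hK v hvK hvi))
    · obtain ⟨k, hkv, hki⟩ := Set.not_subset.1 hvn
      have hkv : G.Adj k v := SimpleGraph.Adj.symm hkv
      have hki : ¬ G.Adj k i := fun hh => hki hh.symm
      have hkK : k ∈ K := (h.mem_or k).resolve_right fun hkI => h.not_adj hkI hvI hkv
      -- The vertex `k ∈ N(v) \ N(i)` is removed before position `j`, so `v ∉ F` would contradict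
      -- minimality.
      obtain ⟨m, hm, hmk⟩ := List.mem_take_iff_getElem.1 (hK k hkK hki)
      by_contra hvF
      have hm' : m < j := by omega
      exact hmin m hm' ⟨by omega, by rw [hmk]; exact hkK, v, hvI, hvF, by rw [hmk]; exact hkv⟩
  refine ⟨i, hiI, F \ fos G K I i, ⟨?_, ?_⟩, (Finset.union_sdiff_of_subset hfos).symm⟩
  · intro v hv
    rw [Finset.mem_sdiff] at hv
    exact mem_ufs.2 ⟨hv.2, by rintro rfl; exact hiF hv.1⟩
  · rintro a ha b hb ⟨haK, hbI, hab⟩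
    rw [Finset.mem_sdiff] at ha ⊢
    rw [mem_ufs] at hb
    refine ⟨?_, hb.1⟩
    by_contra hbF
    -- Being unforced, `a` is adjacent to `i`. If `b` were not in `F`, then `i` and `b` would both
    -- be present when `a` is removed, and they are not adjacent.
    have hai : G.Adj a i := by
      by_contra hcon
      exact ha.2 (mem_fos.2 (Or.inl ⟨haK, hcon⟩))
    obtain ⟨m, hm, rfl⟩ := List.getElem_of_mem ((hl a).1 ha.1)
    have := (isSimplicialOff_iff.1 (hs m hm)).2 i b hai (hil m) hab
      (fun hm => hbF ((hl b).2 (List.mem_of_mem_take hm))) hb.2.symm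
    exact h.not_adj hiI hbI this

theorem disjoint_fos_of_subset_ufs {i : V} {T : Finset V} (hT : T ⊆ ufs G K I i) :
    Disjoint (fos G K I i) T :=
  Finset.disjoint_left.2 fun _ hv hvT => (mem_ufs.1 (hT hvT)).1 hv

/-- Within the family belonging to `i`, the weight is that of `fos(i)` plus that of the filter, so
optimizing the filter optimizes the family; the families cover all feasible sets. -/
theorem IsSplitPartition.isMaxWeight_of_closures [DecidableEq V] (h : IsSplitPartition G K I)
    (w : V → ℝ) {S : Finset V} {T : V → Finset V}
    (hS : IsMaxWeight (filters (prec G K I) Finset.univ) w S)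
    (hT : ∀ i ∈ I, IsMaxWeight (filters (prec G K I) (ufs G K I i)) w (T i)) {F : Finset V}
    (hF : IsMaxWeight ({S} ∪ {F' | ∃ i ∈ I, F' = fos G K I i ∪ T i}) w F) :
    IsMaxWeight (feasibleSets G) w F := by
  constructor
  · rcases hF.1 with rfl | ⟨i, hi, rfl⟩
    · exact h.filter_feasible Finset.mem_univ hS.1
    · exact h.fos_union_feasible hi (hT i hi).1
  · intro F' hF'
    rcases h.feasible_cases hF' with hf | ⟨i, hi, T', hT', rfl⟩
    · exact (hS.2 F' hf).trans (hF.2 S (Or.inl rfl))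
    · refine le_trans ?_ (hF.2 (fos G K I i ∪ T i) (Or.inr ⟨i, hi, rfl⟩))
      rw [weight_union w (disjoint_fos_of_subset_ufs hT'.1),
        weight_union w (disjoint_fos_of_subset_ufs (hT i hi).1.1)]
      exact add_le_add_right ((hT i hi).2 T' hT') _

end FeasibleSets

/-! ### A canonical partition of a split graph -/

section CanonicalPartition

variable {V : Type*} [LinearOrder V]

/-- The vertices that are not simplicial, or adjacent to a smaller simplicial vertex. -/
def canonicalClique (G : SimpleGraph V) : Set V :=
  {v | ¬ IsSimplicialOff G ∅ v ∨ ∃ u < v, G.Adj u v ∧ IsSimplicialOff G ∅ u}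

/-- This makes a partition computable from the graph alone. Relative to any given partition, every
non-simplicial vertex is in `K`. A vertex of the canonical clique that lies in `I` has a simplicial
neighbour `u ∈ K`, whose neighbourhood is a clique containing the rest of `K`; so that vertex is
adjacent to all of `K`. Conversely, of two adjacent simplicial vertices the larger one is put in the
clique. -/
theorem isSplitPartition_canonicalClique {G : SimpleGraph V} (hG : IsSplit G) :
    IsSplitPartition G (canonicalClique G) (canonicalClique G)ᶜ := by
  obtain ⟨K, I, h⟩ := hG
  have hsimp : ∀ {v}, IsSimplicialOff G ∅ v ↔
      ∀ a b, G.Adj v a → G.Adj v b → a ≠ b → G.Adj a b := by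
    intro v
    rw [isSimplicialOff_iff]
    simp
  have hI : ∀ v ∈ I, IsSimplicialOff G ∅ v := fun v hv =>
    h.isSimplicialOff_of_mem_right hv (by simp)
  have hC : ∀ v ∈ canonicalClique G, v ∈ I → ∃ u ∈ K, G.Adj u v ∧ IsSimplicialOff G ∅ u := by
    rintro v (hv | ⟨u, -, huv, hu⟩) hvI
    · exact absurd (hI v hvI) hv
    · exact ⟨u, (h.mem_or u).resolve_right fun huI => h.not_adj huI hvI huv, huv, hu⟩
  have hKI : ∀ a ∈ K, ∀ b ∈ canonicalClique G, b ∈ I → a ≠ b → G.Adj a b := by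
    intro a ha b hb hbI hab
    obtain ⟨u, huK, hub, hu⟩ := hC b hb hbI
    by_cases hua : u = a
    · subst hua; exact hub
    · exact hsimp.1 hu a b (h.adj huK ha hua) hub hab
  refine ⟨disjoint_compl_right, Set.union_compl_self _, ?_, ?_⟩
  · intro a ha b hb hab
    rcases h.mem_or a with haK | haI
    · rcases h.mem_or b with hbK | hbI
      · exact h.adj haK hbK hab
      · exact hKI a haK b hb hbI hab
    · rcases h.mem_or b with hbK | hbI
      · exact (hKI b hbK a ha haI hab.symm).symm
      · obtain ⟨u, huK, hua, hu⟩ := hC a ha haI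
        have hub : u ≠ b := by rintro rfl; exact h.not_mem_right huK hbI
        exact hsimp.1 hu a b hua (hKI u huK b hb hbI hub) hab
  · intro a ha b hb hab hadj
    simp only [canonicalClique, Set.mem_compl_iff, Set.mem_ofPred_eq, not_or, not_not,
      not_exists, not_and] at ha hb
    rcases lt_or_gt_of_ne hab with hlt | hlt
    · exact hb.2 a hlt hadj ha.1
    · exact ha.2 b hlt hadj.symm hb.1

end CanonicalPartition

/-! ### Duality for maximum closures -/

section Duality

variable {V : Type*} [Fintype V]

theorem weight_add_outflow_eq (w e : V → ℝ) (x : V → V → ℝ)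
    (he : ∀ v, e v = w v + ∑ u, x u v - ∑ u, x v u) (H : Finset V) :
    weight w H = ∑ v ∈ H, e v + ∑ v ∈ H, ∑ u, x v u - ∑ v ∈ H, ∑ u, x u v := by
  rw [Finset.sum_congr rfl fun v _ => he v, Finset.sum_sub_distrib, Finset.sum_add_distrib]
  unfold weight
  ring

/-- Complementary slackness for maximum-weight filters. -/
theorem isMaxWeight_filters_of_slackness {r : V → V → Prop} {U : Finset V} {w e : V → ℝ}
    {x : V → V → ℝ} (hx : ∀ u v, 0 ≤ x u v)
    (hxr : ∀ u v, x u v ≠ 0 → u ∈ U ∧ v ∈ U ∧ r u v)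
    (he : ∀ v, e v = w v + ∑ u, x u v - ∑ u, x v u)
    {H : Finset V} (hH : H ∈ filters r U) (hpos : ∀ v ∈ H, 0 ≤ e v)
    (hneg : ∀ v ∈ U, v ∉ H → e v ≤ 0) (hback : ∀ u v, 0 < x u v → v ∈ H → u ∈ H) :
    IsMaxWeight (filters r U) w H := by
  classical
  -- Flow lives on arcs of the order, and these do not leave a filter: all outflow stays inside.
  have hout : ∀ H' ∈ filters r U,
      ∑ v ∈ H', ∑ u, x v u = ∑ v ∈ H', ∑ u ∈ H', x v u := by
    intro H' hH'
    refine Finset.sum_congr rfl fun v hv => (Finset.sum_subset (Finset.subset_univ _) ?_).symm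
    intro u _ hu
    by_contra hne
    exact hu (hH'.2 v hv u (hxr v u hne).2.1 (hxr v u hne).2.2)
  have hle : ∀ H' : Finset V, ∑ v ∈ H', ∑ u ∈ H', x v u ≤ ∑ v ∈ H', ∑ u, x u v := by
    intro H'
    rw [Finset.sum_comm]
    exact Finset.sum_le_sum fun v _ =>
      Finset.sum_le_sum_of_subset_of_nonneg (Finset.subset_univ _) fun u _ _ => hx u v
  -- For `H` no flow enters from outside either, so its internal flow cancels and `w(H) = e(H)`; any
  -- other filter only has `w(H') ≤ e(H')`.
  have heq : ∑ v ∈ H, ∑ u ∈ H, x v u = ∑ v ∈ H, ∑ u, x u v := by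
    rw [Finset.sum_comm]
    refine Finset.sum_congr rfl fun v hv => Finset.sum_subset (Finset.subset_univ _) ?_
    intro u _ hu
    by_contra hne
    exact hu (hback u v (lt_of_le_of_ne (hx u v) (Ne.symm hne)) hv)
  refine ⟨hH, fun H' hH' => ?_⟩
  have h1 : weight w H' ≤ ∑ v ∈ H', e v := by
    rw [weight_add_outflow_eq w e x he, hout H' hH']
    linarith [hle H']
  have h2 : weight w H = ∑ v ∈ H, e v := by
    rw [weight_add_outflow_eq w e x he, hout H hH, heq]
    ring
  have h3 : ∑ v ∈ H', e v ≤ ∑ v ∈ H' ∩ H, e v := by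
    rw [← Finset.sum_inter_add_sum_sdiff H' H]
    have : ∑ v ∈ H' \ H, e v ≤ 0 := Finset.sum_nonpos fun v hv => by
      rw [Finset.mem_sdiff] at hv
      exact hneg v (hH'.1 hv.1) hv.2
    linarith
  have h4 : ∑ v ∈ H' ∩ H, e v ≤ ∑ v ∈ H, e v :=
    Finset.sum_le_sum_of_subset_of_nonneg Finset.inter_subset_right fun v hv _ => hpos v hv
  linarith

end Duality

/-! ### Augmentation of flows and Picard's reduction -/

section Picard

open scoped NNReal ENNReal

section Augmentation

variable {N : Type*} {c : N → N → ℝ≥0∞} {f : N → N → ℝ≥0}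

/-- The directions in which the flow `f` can be changed without violating a capacity. -/
def IsFeasibleDirection (c : N → N → ℝ≥0∞) (f : N → N → ℝ≥0) (g : N → N → ℝ) : Prop :=
  ∃ ε : ℝ, 0 < ε ∧ ∀ a b, 0 ≤ f a b + ε * g a b ∧ ENNReal.ofReal (f a b + ε * g a b) ≤ c a b

theorem ofReal_le_of_le_max {x y z : ℝ} {C : ℝ≥0∞} (hx : ENNReal.ofReal x ≤ C)
    (hy : ENNReal.ofReal y ≤ C) (hz : z ≤ max x y) : ENNReal.ofReal z ≤ C := by
  rcases le_max_iff.1 hz with h | h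
  · exact (ENNReal.ofReal_le_ofReal h).trans hx
  · exact (ENNReal.ofReal_le_ofReal h).trans hy

/-- A shorter step ends between `f` and the admissible endpoint, entry by entry. Capacities may be
infinite, whence the formulation through `ENNReal.ofReal`. -/
theorem IsFeasibleDirection.mono (hf : ∀ a b, (f a b : ℝ≥0∞) ≤ c a b) {g : N → N → ℝ} {ε δ : ℝ}
    (hδ : 0 < δ) (hδε : δ ≤ ε)
    (h : ∀ a b, 0 ≤ f a b + ε * g a b ∧ ENNReal.ofReal (f a b + ε * g a b) ≤ c a b) (a b : N) :
    0 ≤ f a b + δ * g a b ∧ ENNReal.ofReal (f a b + δ * g a b) ≤ c a b := by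
  have hf' : ENNReal.ofReal (f a b) ≤ c a b := by
    rw [ENNReal.ofReal_coe_nnreal]; exact hf a b
  have hf0 : (0 : ℝ) ≤ f a b := (f a b).2
  rcases le_total 0 (g a b) with hg | hg
  · refine ⟨by positivity, ofReal_le_of_le_max hf' (h a b).2 (le_max_of_le_right ?_)⟩
    nlinarith
  · refine ⟨?_, ofReal_le_of_le_max hf' (h a b).2 (le_max_of_le_left ?_)⟩
    · have := (h a b).1
      nlinarith
    · nlinarith

/-- By convexity: the midpoint of two admissible flows reached with the same step is admissible. -/
theorem IsFeasibleDirection.add (hf : ∀ a b, (f a b : ℝ≥0∞) ≤ c a b) {g h : N → N → ℝ}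
    (hg : IsFeasibleDirection c f g) (hh : IsFeasibleDirection c f h) :
    IsFeasibleDirection c f (fun a b => g a b + h a b) := by
  obtain ⟨ε, hε, hg⟩ := hg
  obtain ⟨δ, hδ, hh⟩ := hh
  have hm : 0 < min ε δ := lt_min hε hδ
  refine ⟨min ε δ / 2, half_pos hm, fun a b => ?_⟩
  have h1 := IsFeasibleDirection.mono hf hm (min_le_left ε δ) hg a b
  have h2 := IsFeasibleDirection.mono hf hm (min_le_right ε δ) hh a b
  have h3 : f a b + min ε δ / 2 * (g a b + h a b) =
      ((f a b + min ε δ * g a b) + (f a b + min ε δ * h a b)) / 2 := by ring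
  rw [h3]
  refine ⟨by linarith [h1.1, h2.1], ofReal_le_of_le_max h1.2 h2.2 ?_⟩
  have := le_max_left (f a b + min ε δ * g a b) (f a b + min ε δ * h a b)
  have := le_max_right (f a b + min ε δ * g a b) (f a b + min ε δ * h a b)
  linarith

open Classical in
/-- The unit flow along the arc from `x` to `y`. -/
noncomputable def unitFlow (x y a b : N) : ℝ := if a = x ∧ b = y then 1 else 0

theorem isFeasibleDirection_unitFlow (hf : ∀ a b, (f a b : ℝ≥0∞) ≤ c a b) {x y : N}
    (hxy : (f x y : ℝ≥0∞) < c x y) : IsFeasibleDirection c f (unitFlow x y) := by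
  -- A finite value strictly between flow and capacity gives the step, also when the capacity is
  -- infinite.
  obtain ⟨d, hd1, hd2⟩ := ENNReal.lt_iff_exists_nnreal_btwn.1 hxy
  have hd1 : f x y < d := by exact_mod_cast hd1
  refine ⟨d - f x y, sub_pos.2 (by exact_mod_cast hd1), fun a b => ?_⟩
  unfold unitFlow
  split_ifs with hab
  · obtain ⟨rfl, rfl⟩ := hab
    rw [show (f a b : ℝ) + (d - f a b) * 1 = d by ring]
    exact ⟨d.2, by rw [ENNReal.ofReal_coe_nnreal]; exact hd2.le⟩
  · rw [mul_zero, add_zero, ENNReal.ofReal_coe_nnreal]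
    exact ⟨(f a b).2, hf a b⟩

theorem isFeasibleDirection_neg_unitFlow (hf : ∀ a b, (f a b : ℝ≥0∞) ≤ c a b) {x y : N}
    (hxy : 0 < f x y) : IsFeasibleDirection c f (fun a b => -unitFlow x y a b) := by
  refine ⟨f x y, hxy, fun a b => ?_⟩
  dsimp only [unitFlow]
  split_ifs with hab
  · obtain ⟨rfl, rfl⟩ := hab
    rw [show (f a b : ℝ) + f a b * -1 = 0 by ring]
    simp
  · rw [neg_zero, mul_zero, add_zero, ENNReal.ofReal_coe_nnreal]
    exact ⟨(f a b).2, hf a b⟩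

variable [Fintype N]

open Classical in
theorem sum_unitFlow_left (x y v : N) : ∑ b, unitFlow x y v b = if v = x then 1 else 0 := by
  unfold unitFlow
  by_cases h : v = x <;> simp [h]

open Classical in
theorem sum_unitFlow_right (x y v : N) : ∑ b, unitFlow x y b v = if v = y then 1 else 0 := by
  unfold unitFlow
  by_cases h : v = y <;> simp [h]

open Classical in
-- Along the path, add the unit flow of each forward arc and subtract that of each backward arc. As
-- feasible directions add up, the path need not be simple and no bottleneck has to be computed.
theorem ResidualReach.exists_direction (hf : ∀ a b, (f a b : ℝ≥0∞) ≤ c a b) {s t : N}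
    (h : ResidualReach c f s t) :
    ∃ g, IsFeasibleDirection c f g ∧ ∀ v, ∑ b, g v b - ∑ b, g b v =
      (if v = s then 1 else 0) - (if v = t then 1 else 0) := by
  induction h with
  | refl =>
    refine ⟨fun _ _ => 0, ⟨1, one_pos, fun a b => ?_⟩, fun v => by simp⟩
    rw [mul_zero, add_zero, ENNReal.ofReal_coe_nnreal]
    exact ⟨(f a b).2, hf a b⟩
  | @tail x y _ hxy ih =>
    obtain ⟨g, hg, hdiv⟩ := ih
    rcases hxy with hxy | hxy
    · refine ⟨_, hg.add hf (isFeasibleDirection_unitFlow hf hxy), fun v => ?_⟩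
      rw [Finset.sum_add_distrib, Finset.sum_add_distrib, sum_unitFlow_left, sum_unitFlow_right]
      linarith [hdiv v]
    · refine ⟨_, hg.add hf (isFeasibleDirection_neg_unitFlow hf hxy), fun v => ?_⟩
      rw [Finset.sum_add_distrib, Finset.sum_add_distrib, Finset.sum_neg_distrib,
        Finset.sum_neg_distrib, sum_unitFlow_left, sum_unitFlow_right]
      linarith [hdiv v]

/-- There is no augmenting path for a maximum flow. -/
theorem IsMaxFlow.not_residualReach {s t : N} (hst : s ≠ t) (h : IsMaxFlow c s t f) :
    ¬ ResidualReach c f s t := by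
  classical
  intro hr
  obtain ⟨g, ⟨ε, hε, hg⟩, hdiv⟩ := hr.exists_direction h.1.capacity
  set f' : N → N → ℝ≥0 := fun a b => ⟨f a b + ε * g a b, (hg a b).1⟩ with hf'
  have hcoe : ∀ a b, (f' a b : ℝ) = f a b + ε * g a b := fun a b => rfl
  have hflow : IsFlow c s t f' := by
    refine ⟨fun a b => ?_, fun a has hat => ?_⟩
    · have := (hg a b).2
      rwa [← hcoe, ENNReal.ofReal_coe_nnreal] at this
    · have h1 : (∑ b, (f b a : ℝ)) = ∑ b, (f a b : ℝ) := by
        exact_mod_cast h.1.conservation a has hat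
      have h2 := hdiv a
      rw [if_neg has, if_neg hat] at h2
      have h3 : (∑ b, (f' b a : ℝ)) = ∑ b, (f' a b : ℝ) := by
        simp only [hcoe, Finset.sum_add_distrib, ← Finset.mul_sum]
        rw [h1, show ∑ b, g a b = ∑ b, g b a by linarith]
      exact_mod_cast h3
  have h1 := h.2 f' hflow
  have h2 := hdiv s
  rw [if_pos rfl, if_neg hst] at h2
  unfold flowValue at h1
  simp only [hcoe, Finset.sum_add_distrib, ← Finset.mul_sum] at h1
  have h3 : ∑ b, g s b = 1 + ∑ b, g b s := by linarith
  rw [h3] at h1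
  linarith

end Augmentation

variable {V : Type*} [Fintype V]

/-- Complementary slackness with `x` the flow inside `V` and `e(v) = w(v) + f(v,t) - f(s,v)`. On the
source side the arcs to `t` are saturated, so `e ≥ 0`; off it the arcs from `s` are, so `e ≤ 0`.
Infinite arcs make the side a filter, and flow entering it would give a backward residual arc. -/
theorem isMaxWeight_sourceSide {r : V → V → Prop} {U : Finset V} {w : V → ℝ}
    {f : Node V → Node V → ℝ≥0} (h : IsMaxFlow (picard r U w) source sink f) :
    IsMaxWeight (filters r U) w (sourceSide r U w f) := by
  classical
  have hcap := h.1.capacity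
  have hzero : ∀ a b, picard r U w a b = 0 → f a b = 0 := by
    intro a b hab
    have := hcap a b
    rw [hab] at this
    simpa using this
  have hmem : ∀ v, v ∈ sourceSide r U w f ↔
      ResidualReach (picard r U w) f source (Sum.inl v) := by
    intro v; simp [sourceSide]
  have hsink : ¬ ResidualReach (picard r U w) f source sink :=
    h.not_residualReach (by simp)
  have hsub : sourceSide r U w f ⊆ U := by
    intro v hv
    by_contra hvU
    rw [hmem] at hv
    rcases Relation.ReflTransGen.cases_tail hv with heq | ⟨y, -, hy⟩
    · simp at heq
    · have h1 : ∀ y, picard r U w y (Sum.inl v) = 0 := by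
        rintro (u | (_ | _)) <;> simp [picard, hvU]
      have h2 : ∀ y, picard r U w (Sum.inl v) y = 0 := by
        rintro (u | (_ | _)) <;> simp [picard, hvU]
      rw [h1 y, hzero _ _ (h2 y)] at hy
      simp at hy
  refine isMaxWeight_filters_of_slackness (x := fun u v => (f (Sum.inl u) (Sum.inl v) : ℝ))
    (e := fun v => w v + f (Sum.inl v) sink - f source (Sum.inl v))
    (fun u v => (f _ _).2) ?_ ?_ ⟨hsub, ?_⟩ ?_ ?_ ?_
  · intro u v huv
    by_contra hcon
    refine huv ?_
    rw [hzero _ _ (by simp only [picard]; rw [if_neg hcon])]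
    rfl
  · intro v
    have hc := h.1.conservation (Sum.inl v) (by simp) (by simp)
    have hc : (∑ b, (f b (Sum.inl v) : ℝ)) = ∑ b, (f (Sum.inl v) b : ℝ) := by exact_mod_cast hc
    rw [Fintype.sum_sum_type, Fintype.sum_sum_type, Fintype.sum_bool, Fintype.sum_bool,
      hzero (Sum.inr false) (Sum.inl v) rfl, hzero (Sum.inl v) (Sum.inr true) rfl] at hc
    simp only [NNReal.coe_zero] at hc
    linarith
  · intro a ha b hb hab
    rw [hmem] at ha ⊢
    refine ha.tail (Or.inl ?_)
    simp [picard, hsub ((hmem a).2 ha), hb, hab]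
  · intro v hv
    have hvU := hsub hv
    rw [hmem] at hv
    have h1 : ¬ ((f (Sum.inl v) sink : ℝ≥0∞) < picard r U w (Sum.inl v) sink) := fun hlt =>
      hsink (hv.tail (Or.inl hlt))
    have h2 := hcap source (Sum.inl v)
    simp only [picard, if_pos hvU, not_lt] at h1 h2
    rw [← ENNReal.ofReal_coe_nnreal] at h1
    replace h1 := (ENNReal.ofReal_le_ofReal_iff (NNReal.coe_nonneg _)).1 h1
    rw [← ENNReal.ofReal_coe_nnreal] at h2
    have : (0 : ℝ) ≤ f (Sum.inl v) sink := NNReal.coe_nonneg _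
    rcases ENNReal.ofReal_le_ofReal_iff'.1 h2 with h2 | h2 <;> linarith
  · intro v hvU hv
    rw [hmem] at hv
    have h1 : ¬ ((f source (Sum.inl v) : ℝ≥0∞) < picard r U w source (Sum.inl v)) := fun hlt =>
      hv (Relation.ReflTransGen.single (Or.inl hlt))
    have h2 := hcap (Sum.inl v) sink
    simp only [picard, if_pos hvU, not_lt] at h1 h2
    rw [← ENNReal.ofReal_coe_nnreal] at h1
    replace h1 := (ENNReal.ofReal_le_ofReal_iff (NNReal.coe_nonneg _)).1 h1
    rw [← ENNReal.ofReal_coe_nnreal] at h2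
    have : (0 : ℝ) ≤ f source (Sum.inl v) := NNReal.coe_nonneg _
    rcases ENNReal.ofReal_le_ofReal_iff'.1 h2 with h2 | h2 <;> linarith
  · intro u v huv hv
    rw [hmem] at hv ⊢
    exact hv.tail (Or.inr (by exact_mod_cast huv))

end Picard

/-! ### Pushing and relabelling for maximum closures -/

section PushRelabel

variable {V : Type*}

/-- A pseudoflow `x`, the excess `e` that it leaves at the vertices, and a labelling `d`. -/
@[ext] structure PState (V : Type*) where
  x : V → V → ℝ
  e : V → ℝ
  d : V → ℕ

namespace PState

open Classical in
/-- Increase the flow from `a` to `b` by `δ`. -/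
noncomputable def shift (s : PState V) (a b : V) (δ : ℝ) : PState V where
  x := fun p q => if p = a ∧ q = b then s.x p q + δ else s.x p q
  e := fun v => if v = a then s.e v - δ else if v = b then s.e v + δ else s.e v
  d := s.d

/-- A vertex is active if it has a positive excess and a label below `N`. -/
def Active (N : ℕ) (s : PState V) (u : V) : Prop := 0 < s.e u ∧ s.d u < N

open Classical in
/-- Push as much excess as possible from `u` to `v` if the labels admit it. -/
noncomputable def push (r : V → V → Prop) (N : ℕ) (s : PState V) (u v : V) : PState V :=
  if s.Active N u ∧ s.d u = s.d v + 1 then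
    if r u v then s.shift u v (s.e u)
    else if 0 < s.x v u then
      if s.e u < s.x v u then s.shift v u (-s.e u) else s.shift v u (-s.x v u)
    else s
  else s

open Classical in
/-- Increase the label of `u` by `1` if `u` is active. -/
noncomputable def relabel (N : ℕ) (s : PState V) (u : V) : PState V :=
  if s.Active N u then
    { s with d := fun v => if v = u then s.d v + 1 else s.d v }
  else s

/-- The arc from `u` to `v` is residual. -/
def Residual (r : V → V → Prop) (s : PState V) (u v : V) : Prop := r u v ∨ 0 < s.x v u

variable {r : V → V → Prop} {N : ℕ} {s : PState V}

/-- The effect of a push, by cases. -/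
theorem push_cases (r : V → V → Prop) (N : ℕ) (s : PState V) (u v : V) :
    (s.push r N u v = s ∧ ¬ (s.Active N u ∧ s.d u = s.d v + 1 ∧ s.Residual r u v)) ∨
    (s.Active N u ∧ s.d u = s.d v + 1 ∧
      ((r u v ∧ s.push r N u v = s.shift u v (s.e u)) ∨
       (s.e u < s.x v u ∧ s.push r N u v = s.shift v u (-s.e u)) ∨
       (0 < s.x v u ∧ s.x v u ≤ s.e u ∧ s.push r N u v = s.shift v u (-s.x v u)))) := by
  unfold push Residual
  by_cases h1 : s.Active N u ∧ s.d u = s.d v + 1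
  · rw [if_pos h1]
    by_cases h2 : r u v
    · rw [if_pos h2]
      exact Or.inr ⟨h1.1, h1.2, Or.inl ⟨h2, rfl⟩⟩
    · rw [if_neg h2]
      by_cases h3 : 0 < s.x v u
      · rw [if_pos h3]
        by_cases h4 : s.e u < s.x v u
        · rw [if_pos h4]
          exact Or.inr ⟨h1.1, h1.2, Or.inr (Or.inl ⟨h4, rfl⟩)⟩
        · rw [if_neg h4]
          exact Or.inr ⟨h1.1, h1.2, Or.inr (Or.inr ⟨h3, not_lt.1 h4, rfl⟩)⟩
      · rw [if_neg h3]
        exact Or.inl ⟨rfl, by tauto⟩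
  · rw [if_neg h1]
    exact Or.inl ⟨rfl, by tauto⟩

theorem ne_of_label_eq {u v : V} (h : s.d u = s.d v + 1) : u ≠ v := by
  rintro rfl; omega

theorem push_d (r : V → V → Prop) (N : ℕ) (s : PState V) (u v : V) :
    (s.push r N u v).d = s.d := by
  unfold push
  split_ifs <;> rfl

/-- A push from `u` does not create residual arcs out of `u`. -/
theorem residual_of_push {u v v' : V} (hv : v' ≠ v) (h : (s.push r N u v).Residual r u v') :
    s.Residual r u v' := by
  rcases h with h | h
  · exact Or.inl h
  · right
    rcases push_cases r N s u v with ⟨h1, -⟩ | ⟨-, hd, ⟨-, h1⟩ | ⟨-, h1⟩ | ⟨-, -, h1⟩⟩ <;>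
      rw [h1] at h
    · exact h
    · have huv := ne_of_label_eq hd
      simpa [PState.shift, huv] using h
    · simpa [PState.shift, hv] using h
    · simpa [PState.shift, hv] using h

theorem active_of_push {u v : V} (h : (s.push r N u v).Active N u) : s.Active N u := by
  by_contra hcon
  unfold push at h
  rw [if_neg (fun hh => hcon hh.1)] at h
  exact hcon h

theorem push_of_not_active {u v : V} (h : ¬ s.Active N u) : s.push r N u v = s := by
  unfold push
  rw [if_neg (fun hh => h hh.1)]

variable [Fintype V] {w : V → ℝ}

/-- The invariant of the push-relabel algorithm. -/
structure Inv (r : V → V → Prop) (N : ℕ) (w : V → ℝ) (s : PState V) : Prop where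
  nonneg : ∀ u v, 0 ≤ s.x u v
  arc : ∀ u v, s.x u v ≠ 0 → r u v
  excess : ∀ v, s.e v = w v + ∑ u, s.x u v - ∑ u, s.x v u
  label : ∀ u v, s.Residual r u v → s.d u ≤ s.d v + 1
  deficit : ∀ v, s.e v < 0 → s.d v = 0
  bound : ∀ v, s.d v ≤ N

/-! ### Preservation of the push-relabel invariant -/

theorem inv_initial (r : V → V → Prop) (N : ℕ) (w : V → ℝ) :
    Inv r N w ⟨fun _ _ => 0, w, fun _ => 0⟩ where
  nonneg _ _ := le_rfl
  arc _ _ h := absurd rfl h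
  excess v := by simp
  label _ _ _ := Nat.zero_le _
  deficit _ _ := rfl
  bound _ := Nat.zero_le _

/-- Covers pushes along an arc (`δ > 0`) and back along it (`δ < 0`). The only residual arc that can
appear is the one from `b` to `a`, which `hd` controls. -/
theorem Inv.shift (h : s.Inv r N w) {a b : V} {δ : ℝ} (hab : a ≠ b) (hx : 0 ≤ s.x a b + δ)
    (hr : r a b) (hd : s.d b ≤ s.d a + 1) (ha : s.e a - δ < 0 → s.d a = 0)
    (hb : s.e b + δ < 0 → s.d b = 0) : (s.shift a b δ).Inv r N w := by
  classical
  have hx' : ∀ p q, (s.shift a b δ).x p q = s.x p q + if p = a ∧ q = b then δ else 0 := by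
    intro p q
    simp only [PState.shift]
    split_ifs <;> simp
  refine ⟨fun u v => ?_, fun u v huv => ?_, fun v => ?_, fun u v huv => ?_, fun v hv => ?_,
    h.bound⟩
  · rw [hx']
    split_ifs with hc
    · rw [hc.1, hc.2]; exact hx
    · rw [add_zero]; exact h.nonneg u v
  · by_cases hc : u = a ∧ v = b
    · rw [hc.1, hc.2]; exact hr
    · rw [hx', if_neg hc, add_zero] at huv
      exact h.arc u v huv
  · have h1 : ∑ u, (s.shift a b δ).x u v = ∑ u, s.x u v + if v = b then δ else 0 := by
      simp only [hx', Finset.sum_add_distrib]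
      by_cases hv : v = b <;> simp [hv]
    have h2 : ∑ u, (s.shift a b δ).x v u = ∑ u, s.x v u + if v = a then δ else 0 := by
      simp only [hx', Finset.sum_add_distrib]
      by_cases hv : v = a <;> simp [hv]
    rw [h1, h2]
    have h3 := h.excess v
    simp only [PState.shift]
    by_cases hva : v = a
    · have hvb : v ≠ b := by rw [hva]; exact hab
      rw [if_pos hva, if_neg hvb, if_pos hva]
      linarith
    · by_cases hvb : v = b
      · rw [if_neg hva, if_pos hvb, if_pos hvb, if_neg hva]
        linarith
      · rw [if_neg hva, if_neg hvb, if_neg hvb, if_neg hva]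
        linarith
  · change s.d u ≤ s.d v + 1
    rcases huv with huv | huv
    · exact h.label u v (Or.inl huv)
    · by_cases hc : v = a ∧ u = b
      · rw [hc.1, hc.2]; exact hd
      · rw [hx', if_neg hc, add_zero] at huv
        exact h.label u v (Or.inr huv)
  · change s.d v = 0
    simp only [PState.shift] at hv
    split_ifs at hv with h1 h2
    · rw [h1] at hv ⊢; exact ha hv
    · rw [h2] at hv ⊢; exact hb hv
    · exact h.deficit v hv

theorem Inv.push (h : s.Inv r N w) (u v : V) : (s.push r N u v).Inv r N w := by
  rcases push_cases r N s u v with ⟨h1, -⟩ | ⟨hact, hd, ⟨hr, h1⟩ | ⟨hx, h1⟩ | ⟨hx, hx', h1⟩⟩ <;>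
    rw [h1]
  · exact h
  · have huv := ne_of_label_eq hd
    refine h.shift huv (add_nonneg (h.nonneg u v) hact.1.le) hr (by omega) ?_ ?_
    · intro hlt; simp at hlt
    · intro hlt; exact h.deficit v (by linarith [hact.1])
  · have huv := ne_of_label_eq hd
    refine h.shift huv.symm (by linarith) (h.arc v u (by linarith [hact.1])) (by omega) ?_ ?_
    · intro hlt; exact h.deficit v (by linarith [hact.1])
    · intro hlt; simp at hlt
  · have huv := ne_of_label_eq hd
    refine h.shift huv.symm (by linarith) (h.arc v u hx.ne') (by omega) ?_ ?_
    · intro hlt; exact h.deficit v (by linarith)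
    · intro hlt; linarith

/-- If no residual arc out of `u` descends, raising `u` by 1 keeps the labelling valid. Activity of
`u` keeps deficits at label 0 and labels at most `N`. -/
theorem Inv.relabel (h : s.Inv r N w) {u : V}
    (hu : s.Active N u → ∀ v, s.Residual r u v → s.d u ≤ s.d v) :
    (s.relabel N u).Inv r N w := by
  unfold PState.relabel
  split_ifs with hact
  swap
  · exact h
  refine ⟨h.nonneg, h.arc, h.excess, fun a b hab => ?_, fun v hv => ?_, fun v => ?_⟩
  · have hab' : s.Residual r a b := hab
    have h1 := h.label a b hab'
    dsimp only
    by_cases ha : a = u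
    · subst ha
      have := hu hact b hab'
      split_ifs <;> omega
    · rw [if_neg ha]
      split_ifs <;> omega
  · have hvu : v ≠ u := by
      rintro rfl
      exact absurd hact.1 (not_lt.2 (le_of_lt hv))
    dsimp only
    rw [if_neg hvu]
    exact h.deficit v hv
  · dsimp only
    split_ifs with hvu
    · subst hvu; exact hact.2
    · exact h.bound v

/-- After a push along an arc, this arc does not obstruct a relabelling. -/
theorem push_clears {u v : V} (hact : (s.push r N u v).Active N u)
    (hres : (s.push r N u v).Residual r u v) (h : s.Inv r N w) : s.d u ≤ s.d v := by
  have hd' := push_d r N s u v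
  rcases push_cases r N s u v with ⟨h1, h2⟩ | ⟨-, hd, ⟨hr, h1⟩ | ⟨hx, h1⟩ | ⟨hx, hx', h1⟩⟩ <;>
    rw [h1] at hact hres
  · by_contra hcon
    exact h2 ⟨hact, le_antisymm (h.label u v hres) (by omega), hres⟩
  · have := hact.1
    simp [PState.shift] at this
  · have := hact.1
    have huv := ne_of_label_eq hd
    simp [PState.shift, huv] at this
  -- If `r u v` held, the push would have gone forward and emptied `u`; otherwise the backward arc
  -- has just been saturated.
  · rcases hres with hr | hr
    · have h3 : s.push r N u v = s.shift u v (s.e u) := by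
        have hact0 : s.Active N u := by
          refine ⟨by linarith, ?_⟩
          exact hact.2
        unfold PState.push
        rw [if_pos ⟨hact0, hd⟩, if_pos hr]
      have h4 : (s.shift v u (-s.x v u)).e u = (s.shift u v (s.e u)).e u :=
        congrArg (fun t => PState.e t u) (h1.symm.trans h3)
      have := hact.1
      rw [h4] at this
      simp [PState.shift] at this
    · simp [PState.shift] at hr

/-! The measure that decreases with every effective step. -/

/-- How much the labels can still grow. -/
def slack (N : ℕ) (s : PState V) : ℕ := ∑ v, (N - s.d v)

open Classical in
/-- The admissible arcs of finite residual capacity. -/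
noncomputable def admissibleArcs (s : PState V) : Finset (V × V) :=
  Finset.univ.filter fun p => 0 < s.x p.2 p.1 ∧ s.d p.1 = s.d p.2 + 1

theorem mem_admissibleArcs {p : V × V} :
    p ∈ s.admissibleArcs ↔ 0 < s.x p.2 p.1 ∧ s.d p.1 = s.d p.2 + 1 := by
  simp [admissibleArcs]

/-- The number of admissible arcs of finite residual capacity. -/
noncomputable def admissible (s : PState V) : ℕ := s.admissibleArcs.card

open Classical in
/-- The sum of the labels of the vertices of positive excess. -/
noncomputable def height (s : PState V) : ℕ := ∑ v, if 0 < s.e v then s.d v else 0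

/-- The measure of a state. -/
noncomputable def measure (N : ℕ) (s : PState V) : ℕ :=
  s.slack N * ((Fintype.card V ^ 2 + 1) * (Fintype.card V * N + 1)) +
    s.admissible * (Fintype.card V * N + 1) + s.height

theorem height_le (h : ∀ v, s.d v ≤ N) : s.height ≤ Fintype.card V * N := by
  classical
  unfold height
  refine (Finset.sum_le_card_nsmul _ _ N fun v _ => ?_).trans ?_
  · split_ifs
    · exact h v
    · exact Nat.zero_le _
  · simp

theorem admissible_le : s.admissible ≤ Fintype.card V ^ 2 := by
  classical
  unfold admissible
  refine (Finset.card_le_univ _).trans ?_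
  rw [Fintype.card_prod, sq]

theorem slack_le : s.slack N ≤ Fintype.card V * N := by
  unfold slack
  refine (Finset.sum_le_card_nsmul _ _ N fun v _ => Nat.sub_le _ _).trans ?_
  simp

/-- The measure encodes the lexicographic triple (slack, admissible arcs, height) in mixed radix.
Each of the three radices is at most `(n + 1) ^ 2`, which gives the exponent 6 and hence the six
nested loops of `pushRelabel`. -/
theorem measure_lt (h : ∀ v, s.d v ≤ Fintype.card V + 1) :
    s.measure (Fintype.card V + 1) < (Fintype.card V + 1) ^ 6 := by
  have h1 := height_le h
  have h2 := s.admissible_le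
  have h3 := s.slack_le (N := Fintype.card V + 1)
  unfold measure
  set n := Fintype.card V
  set B := n * (n + 1) + 1
  have hB : B ≤ (n + 1) ^ 2 := by simp only [B]; nlinarith
  have hA : n ^ 2 + 1 ≤ (n + 1) ^ 2 := by nlinarith
  calc s.slack (n + 1) * ((n ^ 2 + 1) * B) + s.admissible * B + s.height
      < n * (n + 1) * ((n ^ 2 + 1) * B) + n ^ 2 * B + B := by
        have e1 := Nat.mul_le_mul_right ((n ^ 2 + 1) * B) h3
        have e2 := Nat.mul_le_mul_right B h2
        omega
    _ = B * ((n ^ 2 + 1) * B) := by simp only [B]; ring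
    _ ≤ (n + 1) ^ 2 * ((n + 1) ^ 2 * (n + 1) ^ 2) := by gcongr
    _ = (n + 1) ^ 6 := by ring

/-- The emptied vertex `u` loses its contribution `d u`, and `v` gains at most `d v = d u - 1`. -/
theorem height_lt_of_push {s' : PState V} {u v : V} (hd : s'.d = s.d) (huv : s.d u = s.d v + 1)
    (hu : 0 < s.e u) (hu' : ¬ 0 < s'.e u) (he : ∀ p, p ≠ u → p ≠ v → s'.e p = s.e p) :
    s'.height < s.height := by
  classical
  have hne := ne_of_label_eq huv
  -- Adding `d u` on one side and `d v` on the other avoids subtraction of natural numbers.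
  have key : ∑ p, ((if 0 < s'.e p then s'.d p else 0) + if p = u then s.d u else 0) ≤
      ∑ p, ((if 0 < s.e p then s.d p else 0) + if p = v then s.d v else 0) := by
    refine Finset.sum_le_sum fun p _ => ?_
    rw [hd]
    by_cases hpu : p = u
    · subst hpu
      rw [if_neg hu', if_pos rfl, if_pos hu]
      omega
    · by_cases hpv : p = v
      · subst hpv
        rw [if_neg hpu, if_pos rfl]
        split_ifs <;> omega
      · rw [if_neg hpu, if_neg hpv, he p hpu hpv]
  rw [Finset.sum_add_distrib, Finset.sum_add_distrib, Finset.sum_ite_eq' , Finset.sum_ite_eq',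
    if_pos (Finset.mem_univ _), if_pos (Finset.mem_univ _)] at key
  unfold height
  omega

/-- A push that empties `u` creates no admissible arc of finite capacity, since its reverse arc goes
up in label, and it lowers the height. A push that saturates a backward arc removes an admissible
arc, which outweighs any growth of the height. Slack is unchanged. -/
theorem measure_push (h : s.Inv r N w) (u v : V) :
    s.push r N u v = s ∨ (s.push r N u v).measure N < s.measure N := by
  classical
  have hdd := push_d r N s u v
  have hh := height_le (h.push u v).bound
  have hslack : (s.push r N u v).slack N = s.slack N := by unfold slack; rw [hdd]
  rcases push_cases r N s u v with ⟨h1, -⟩ | ⟨hact, hd, hcase⟩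
  · exact Or.inl h1
  right
  have hne := ne_of_label_eq hd
  have hcase' : ((s.push r N u v).admissible ≤ s.admissible ∧
      (s.push r N u v).height < s.height) ∨ (s.push r N u v).admissible < s.admissible := by
    rcases hcase with ⟨hr, h1⟩ | ⟨hx, h1⟩ | ⟨hx, hx', h1⟩ <;> rw [h1]
    · left
      refine ⟨Finset.card_le_card fun p => ?_, height_lt_of_push (u := u) (v := v) rfl hd hact.1 ?_ ?_⟩
      · intro hp
        simp only [mem_admissibleArcs, PState.shift] at hp ⊢
        obtain ⟨hp1, hp2⟩ := hp
        refine ⟨?_, hp2⟩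
        rw [if_neg] at hp1
        · exact hp1
        · rintro ⟨h2, h3⟩
          rw [h2, h3] at hp2
          omega
      · simp [PState.shift]
      · intro p hpu hpv
        simp [PState.shift, hpu, hpv]
    · left
      refine ⟨Finset.card_le_card fun p => ?_, height_lt_of_push (u := u) (v := v) rfl hd hact.1 ?_ ?_⟩
      · intro hp
        simp only [mem_admissibleArcs, PState.shift] at hp ⊢
        obtain ⟨hp1, hp2⟩ := hp
        refine ⟨?_, hp2⟩
        split_ifs at hp1 with hc
        · rw [hc.1, hc.2]; linarith [hact.1]
        · exact hp1
      · simp [PState.shift, hne]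
      · intro p hpu hpv
        simp [PState.shift, hpu, hpv]
    · right
      refine Finset.card_lt_card ⟨fun p => ?_, fun hsub => ?_⟩
      · intro hp
        simp only [mem_admissibleArcs, PState.shift] at hp ⊢
        obtain ⟨hp1, hp2⟩ := hp
        refine ⟨?_, hp2⟩
        split_ifs at hp1 with hc
        · rw [hc.1, hc.2]; exact hx
        · exact hp1
      · have hmem : (u, v) ∈ s.admissibleArcs := mem_admissibleArcs.2 ⟨hx, hd⟩
        have := (mem_admissibleArcs.1 (hsub hmem)).1
        simp [PState.shift] at this
  unfold measure
  rw [hslack]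
  set B := Fintype.card V * N + 1
  rcases hcase' with ⟨h2, h3⟩ | h2
  · have := Nat.mul_le_mul_right B h2
    omega
  · have := Nat.mul_le_mul_right B (Nat.succ_le_of_lt h2)
    rw [Nat.succ_mul] at this
    omega

theorem measure_relabel {u : V} (h : (s.relabel N u).Inv r N w) (hact : s.Active N u) :
    (s.relabel N u).measure N < s.measure N := by
  classical
  have h1 := height_le h.bound
  have h2 := (s.relabel N u).admissible_le
  have h3 : (s.relabel N u).slack N < s.slack N := by
    unfold slack
    refine Finset.sum_lt_sum (fun v _ => ?_) ⟨u, Finset.mem_univ u, ?_⟩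
    · unfold PState.relabel
      rw [if_pos hact]
      dsimp only
      split_ifs <;> omega
    · unfold PState.relabel
      rw [if_pos hact]
      have := hact.2
      dsimp only
      rw [if_pos rfl]
      omega
  unfold measure
  set n := Fintype.card V
  set B := n * N + 1
  have e1 := Nat.mul_le_mul_right ((n ^ 2 + 1) * B) (Nat.succ_le_of_lt h3)
  have e2 := Nat.mul_le_mul_right B h2
  rw [Nat.succ_mul, Nat.add_mul (n ^ 2) 1 B, one_mul] at e1
  rw [Nat.add_mul (n ^ 2) 1 B, one_mul]
  omega

/-- A state without active vertices and a label that does not occur determine a maximum-weight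
filter. -/
theorem Inv.isMaxWeight_filter {r' : V → V → Prop} {U : Finset V}
    (hr : ∀ u v, r u v ↔ u ∈ U ∧ v ∈ U ∧ r' u v) (h : s.Inv r N w)
    (hterm : ∀ v, ¬ s.Active N v) {l : ℕ} (hlN : l ≤ N) (hl : ∀ v, s.d v ≠ l) {H : Finset V}
    (hH : ∀ v, v ∈ H ↔ v ∈ U ∧ l < s.d v) : IsMaxWeight (filters r' U) w H := by
  -- Labels drop by at most 1 along a residual arc, so such an arc cannot jump over the missing
  -- label `l`.
  have hstep : ∀ u v, s.Residual r u v → l < s.d u → l < s.d v := by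
    intro u v huv hu
    have := h.label u v huv
    have := hl v
    omega
  refine isMaxWeight_filters_of_slackness h.nonneg
    (fun u v huv => (hr u v).1 (h.arc u v huv)) h.excess ⟨fun v hv => ((hH v).1 hv).1, ?_⟩ ?_ ?_ ?_
  · intro a ha b hb hab
    rw [hH] at ha ⊢
    exact ⟨hb, hstep a b (Or.inl ((hr a b).2 ⟨ha.1, hb, hab⟩)) ha.2⟩
  · intro v hv
    rw [hH] at hv
    by_contra hcon
    have := h.deficit v (not_le.1 hcon)
    omega
  · intro v hvU hv
    by_contra hcon
    rw [hH, not_and, not_lt] at hv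
    have h1 := hv hvU
    have h2 := hl v
    -- A vertex below `l ≤ N` with positive excess would still be active.
    exact hterm v ⟨not_le.1 hcon, by omega⟩
  · intro u v huv hv
    rw [hH] at hv ⊢
    exact ⟨((hr u v).1 (h.arc u v huv.ne')).1, hstep v u (Or.inr huv) hv.2⟩

/-- Some label between `1` and `|V| + 1` does not occur. -/
theorem exists_gap (d : V → ℕ) : ∃ l < Fintype.card V + 1, ∀ v, d v ≠ l + 1 := by
  classical
  by_contra! hcon
  have hsub : (Finset.range (Fintype.card V + 1)).image (· + 1) ⊆ Finset.univ.image d := by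
    intro l hl
    obtain ⟨k, hk, rfl⟩ := Finset.mem_image.1 hl
    obtain ⟨v, hv⟩ := hcon k (Finset.mem_range.1 hk)
    exact Finset.mem_image.2 ⟨v, Finset.mem_univ v, hv⟩
  have h1 := Finset.card_le_card hsub
  rw [Finset.card_image_of_injective _ (add_left_injective 1), Finset.card_range] at h1
  have h2 := Finset.card_image_le (s := (Finset.univ : Finset V)) (f := d)
  rw [Finset.card_univ] at h2
  omega

end PState

end PushRelabel

/-! ### More rules for bounded loops -/

section LoopRules

namespace LProg

variable {v b k : ℕ} {p : LProg} {σ : Memory}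

/-- A property that can only be brought about by a round of the loop, and then persists. -/
theorem for_exists (P : Memory → Prop) (C : ℕ → Prop) (hv : v ∉ p.natWrites)
    (hP : ∀ τ x, P (τ.setNat v 0 x) ↔ P τ)
    (hs : ∀ i < σ.nat 0 b + k, ∀ τ, τ.nat v 0 = i → Frame (for_ v b k p) σ τ →
      (P (p.den τ) ↔ P τ ∨ C i)) :
    P ((for_ v b k p).den σ) ↔ P σ ∨ ∃ i < σ.nat 0 b + k, C i := by
  refine for_induction (fun i τ => P τ ↔ P σ ∨ ∃ j < i, C j) hv ?_ ?_
  · rw [hP]; simp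
  · intro i hi τ hτ hf hJ
    rw [hP, hs i hi τ hτ hf, hJ, or_assoc]
    refine or_congr_right ⟨?_, ?_⟩
    · rintro (⟨j, hj, hC⟩ | hC)
      · exact ⟨j, by omega, hC⟩
      · exact ⟨i, by omega, hC⟩
    · rintro ⟨j, hj, hC⟩
      rcases Nat.lt_succ_iff_lt_or_eq.1 hj with h | rfl
      · exact Or.inl ⟨j, h, hC⟩
      · exact Or.inr hC

/-- A property that is established by one round of the loop and preserved by the others. -/
theorem for_point (P : Memory → Prop) {x : ℕ} (hx : x < σ.nat 0 b + k) (hv : v ∉ p.natWrites)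
    (hP : ∀ τ x, P (τ.setNat v 0 x) ↔ P τ)
    (hset : ∀ τ, τ.nat v 0 = x → Frame (for_ v b k p) σ τ → P (p.den τ))
    (hpres : ∀ i < σ.nat 0 b + k, i ≠ x → ∀ τ, τ.nat v 0 = i → Frame (for_ v b k p) σ τ →
      P τ → P (p.den τ)) :
    P ((for_ v b k p).den σ) := by
  refine for_induction (fun i τ => x < i → P τ) hv (fun h => by omega) ?_ hx
  intro i hi τ hτ hf hJ hxi
  rw [hP]
  by_cases hix : i = x
  · exact hset τ (hτ.trans hix) hf
  · exact hpres i hi hix τ hτ hf (hJ (by omega))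

/-- A property that is preserved by every round of the loop. -/
theorem for_preserves (P : Memory → Prop) (hv : v ∉ p.natWrites)
    (hP : ∀ τ x, P (τ.setNat v 0 x) ↔ P τ)
    (hs : ∀ i < σ.nat 0 b + k, ∀ τ, τ.nat v 0 = i → Frame (for_ v b k p) σ τ →
      P τ → P (p.den τ)) (h : P σ) :
    P ((for_ v b k p).den σ) := by
  refine for_induction (fun _ τ => P τ) hv ((hP _ _).2 h) ?_
  intro i hi τ hτ hf hJ
  exact (hP _ _).2 (hs i hi τ hτ hf hJ)

end LProg

/-- Row-major indexing: different matrix entries occupy different cells of one array. -/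
theorem pair_inj {n u v u' v' : ℕ} (hv : v < n) (hv' : v' < n) :
    u * n + v = u' * n + v' ↔ u = u' ∧ v = v' := by
  constructor
  · intro h
    have h1 : u = u' := by
      have h2 : (u * n + v) / n = u := by
        rw [Nat.mul_comm, Nat.mul_add_div (by omega), Nat.div_eq_of_lt hv, add_zero]
      have h3 : (u' * n + v') / n = u' := by
        rw [Nat.mul_comm, Nat.mul_add_div (by omega), Nat.div_eq_of_lt hv', add_zero]
      rw [← h2, h, h3]
    subst h1
    exact ⟨rfl, by omega⟩
  · rintro ⟨rfl, rfl⟩; rfl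

end LoopRules

/-! ### The program: preprocessing

Memory layout, arrays of natural numbers: `0` sizes, `1` and `2` listed edges, `3` output,
`4` offsets of the rows of a matrix, `5` adjacency matrix, `6` marks of the vertices that are not
simplicial, `7` marks of the vertices of the clique, `8` status of the vertices in the current
closure problem, `9` labels, `10` a missing label, `11` a mark, from `20` on loop variables.
Arrays of real numbers: `0` weights, `1` excesses, `2` pseudoflow, `3` weight of the current set,
`4` weight of the output. -/

section Preprocessing

namespace LProg

/-- The value of a scalar variable. -/
def var (a : ℕ) : NExp := .cell a (.const 0)

/-- The index of a matrix entry. -/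
def entry (u v : NExp) : NExp := .plus (.cell 4 u) v

/-- The test for a natural number to be positive. -/
def pos (e : NExp) : Test := .natLt (.const 0) e

/-- The test for two natural numbers to be equal. -/
def eq (e f : NExp) : Test := .both (.neg (.natLt e f)) (.neg (.natLt f e))

/-- The disjunction of two tests. -/
def or (s t : Test) : Test := .neg (.both (.neg s) (.neg t))

/-- The test for adjacency. -/
def adj (u v : NExp) : Test := pos (.cell 5 (entry u v))

variable {σ : Memory}

@[simp] theorem eval_var (a : ℕ) : (var a).eval σ = σ.nat a 0 := rfl

@[simp] theorem eval_entry (u v : NExp) :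
    (entry u v).eval σ = σ.nat 4 (u.eval σ) + v.eval σ := rfl

@[simp] theorem eval_const (c : ℕ) : (NExp.const c).eval σ = c := rfl

@[simp] theorem eval_cell (a : ℕ) (j : NExp) : (NExp.cell a j).eval σ = σ.nat a (j.eval σ) := rfl

@[simp] theorem eval_plus (e f : NExp) : (NExp.plus e f).eval σ = e.eval σ + f.eval σ := rfl

@[simp] theorem wEval_zero : WExp.zero.eval σ = 0 := rfl

@[simp] theorem wEval_cell (a : ℕ) (j : NExp) : (WExp.cell a j).eval σ = σ.wt a (j.eval σ) := rfl

@[simp] theorem wEval_plus (e f : WExp) : (WExp.plus e f).eval σ = e.eval σ + f.eval σ := rfl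

@[simp] theorem wEval_minus (e f : WExp) : (WExp.minus e f).eval σ = e.eval σ - f.eval σ := rfl

@[simp] theorem holds_natLt (e f : NExp) : (Test.natLt e f).Holds σ ↔ e.eval σ < f.eval σ := Iff.rfl

@[simp] theorem holds_wtLt (e f : WExp) : (Test.wtLt e f).Holds σ ↔ e.eval σ < f.eval σ := Iff.rfl

@[simp] theorem holds_neg (t : Test) : (Test.neg t).Holds σ ↔ ¬ t.Holds σ := Iff.rfl

@[simp] theorem holds_both (s t : Test) :
    (Test.both s t).Holds σ ↔ s.Holds σ ∧ t.Holds σ := Iff.rfl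

@[simp] theorem holds_pos (e : NExp) : (pos e).Holds σ ↔ 0 < e.eval σ := Iff.rfl

@[simp] theorem holds_eq (e f : NExp) : (eq e f).Holds σ ↔ e.eval σ = f.eval σ := by
  simp only [eq, holds_both, holds_neg, holds_natLt]
  omega

@[simp] theorem holds_or (s t : Test) : (or s t).Holds σ ↔ s.Holds σ ∨ t.Holds σ := by
  simp only [or, holds_both, holds_neg]
  tauto

@[simp] theorem holds_adj (u v : NExp) :
    (adj u v).Holds σ ↔ 0 < σ.nat 5 (σ.nat 4 (u.eval σ) + v.eval σ) := Iff.rfl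

/-- Set a mark if a test succeeds. -/
def mark (a : ℕ) (j : NExp) (t : Test) : LProg := ite t (setNat a j (.const 1)) skip

theorem mark_pos (a : ℕ) (j : NExp) (t : Test) (σ : Memory) (x : ℕ) :
    0 < ((mark a j t).den σ).nat a x ↔ 0 < σ.nat a x ∨ (j.eval σ = x ∧ t.Holds σ) := by
  simp only [mark, den]
  split_ifs with h
  · simp only [Memory.setNat_nat, eval_const, true_and, h, and_true]
    split_ifs with hx
    · simp [hx]
    · simp [Ne.symm hx]
  · simp [h]

/-- Compute the offsets of the rows. -/
def rows : LProg :=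
  for_ 20 0 0 (setNat 4 (.plus (var 20) (.const 1)) (.plus (.cell 4 (var 20)) (var 0)))

/-- The machine cannot multiply, so the row offsets `u * n` are tabulated by repeated addition. -/
theorem rows_spec {n : ℕ} (hn : σ.nat 0 0 = n) (h0 : σ.nat 4 0 = 0) {u : ℕ} (hu : u ≤ n) :
    (rows.den σ).nat 4 u = u * n := by
  have key : ∀ u ≤ σ.nat 0 0 + 0, (rows.den σ).nat 4 u = u * n := by
    refine for_induction (fun i τ => ∀ u ≤ i, τ.nat 4 u = u * n) (by decide) ?_ ?_
    · intro u hu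
      obtain rfl : u = 0 := by omega
      simpa using h0
    · intro i hi τ hτ hf hJ u hu
      have hn' : τ.nat 0 0 = n := by rw [hf.nat 0 (by decide), hn]
      have hJi := hJ i le_rfl
      by_cases hui : u = i + 1
      · simp [den, hτ, hn', hui, hJi]
        ring
      · simp [den, hτ, hui, hJ u (by omega)]
  exact key u (by omega)

/-- Compute the adjacency matrix. -/
def matrix : LProg :=
  for_ 20 1 0 (seq
    (setNat 5 (entry (.cell 1 (var 20)) (.cell 2 (var 20))) (.const 1))
    (setNat 5 (entry (.cell 2 (var 20)) (.cell 1 (var 20))) (.const 1)))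

theorem matrix_spec {n : ℕ} (hrow : ∀ u < n, σ.nat 4 u = u * n) (h0 : ∀ j, σ.nat 5 j = 0)
    {es : List (Fin n × Fin n)} (hlen : σ.nat 0 1 = es.length)
    (h1 : ∀ j (hj : j < es.length), σ.nat 1 j = es[j].1)
    (h2 : ∀ j (hj : j < es.length), σ.nat 2 j = es[j].2) (u v : Fin n) :
    0 < (matrix.den σ).nat 5 (u * n + v) ↔ (u, v) ∈ es ∨ (v, u) ∈ es := by
  unfold matrix
  rw [for_exists (fun τ => 0 < τ.nat 5 (u * n + v))
    (fun i => ∃ h : i < es.length, es[i] = (u, v) ∨ es[i] = (v, u)) (by decide) (by simp)]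
  · rw [h0, List.mem_iff_getElem, List.mem_iff_getElem, hlen]
    constructor
    · rintro (h | ⟨i, hi, h, h' | h'⟩)
      · omega
      · exact Or.inl ⟨i, h, h'⟩
      · exact Or.inr ⟨i, h, h'⟩
    · rintro (⟨i, h, h'⟩ | ⟨i, h, h'⟩)
      · exact Or.inr ⟨i, h, h, Or.inl h'⟩
      · exact Or.inr ⟨i, h, h, Or.inr h'⟩
  · intro i hi τ hτ hf
    have hi : i < es.length := by omega
    simp only [den, Memory.setNat_nat, eval_entry, eval_cell, eval_var, hτ, eval_const,
      true_and, (by decide : (4 : ℕ) ≠ 5), (by decide : (20 : ℕ) ≠ 5), (by decide : (1 : ℕ) ≠ 5),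
      (by decide : (2 : ℕ) ≠ 5), false_and, if_false, hf.nat 1 (by decide), hf.nat 2 (by decide),
      hf.nat 4 (by decide), h1 i hi, h2 i hi, hrow _ (Fin.is_lt _), pair_inj v.2 (Fin.is_lt _),
      exists_prop_of_true hi, Fin.val_inj]
    rw [Prod.ext_iff, Prod.ext_iff]
    split_ifs with ha hb
    · simp [ha.1, ha.2]
    · simp [hb.1, hb.2]
    · simp only [not_and] at ha hb
      constructor
      · exact Or.inl
      · rintro (h | ⟨h, h'⟩ | ⟨h, h'⟩)
        · exact h
        · exact absurd h'.symm (hb h.symm)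
        · exact absurd h.symm (ha h'.symm)

/-- Mark the vertices that are not simplicial. -/
def nonsimplicial : LProg :=
  for_ 20 0 0 (for_ 21 0 0 (for_ 22 0 0 (mark 6 (var 20)
    (.both (.both (adj (var 20) (var 21)) (adj (var 20) (var 22)))
      (.both (.neg (eq (var 21) (var 22))) (.neg (adj (var 21) (var 22))))))))

theorem nonsimplicial_spec {n : ℕ} (hn : σ.nat 0 0 = n) (hrow : ∀ u < n, σ.nat 4 u = u * n)
    {G : SimpleGraph (Fin n)} (hadj : ∀ u v : Fin n, 0 < σ.nat 5 (u * n + v) ↔ G.Adj u v)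
    (h0 : ∀ j, σ.nat 6 j = 0) (x : Fin n) :
    0 < (nonsimplicial.den σ).nat 6 x ↔ ¬ IsSimplicialOff G ∅ x := by
  unfold nonsimplicial
  rw [for_exists (fun τ => 0 < τ.nat 6 x)
    (fun i => ∃ j < n, ∃ k < n, i = x ∧ ((0 < σ.nat 5 (i * n + j) ∧ 0 < σ.nat 5 (i * n + k)) ∧
      j ≠ k ∧ ¬ 0 < σ.nat 5 (j * n + k))) (by decide) (by simp)]
  · rw [h0, isSimplicialOff_iff, hn]
    simp only [lt_irrefl, false_or, add_zero, Set.mem_empty_iff_false, not_false_eq_true,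
      true_and, forall_const]
    push Not
    constructor
    · rintro ⟨i, hi, j, hj, k, hk, rfl, ⟨h1, h2⟩, h3, h4⟩
      have h1 := (hadj x ⟨j, hj⟩).1 h1
      have h2 := (hadj x ⟨k, hk⟩).1 h2
      refine ⟨⟨j, hj⟩, ⟨k, hk⟩, h1, h2, ?_, ?_⟩
      · simpa using h3
      · rw [← hadj]; exact not_lt.2 h4
    · rintro ⟨a, b, h1, h2, h3, h4⟩
      refine ⟨x, x.2, a, a.2, b, b.2, rfl, ⟨(hadj x a).2 h1, (hadj x b).2 h2⟩, ?_, ?_⟩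
      · simpa [Fin.val_inj] using h3
      · rw [← hadj] at h4; exact not_lt.1 h4
  · intro i hi τ hτ hf
    have hn1 : τ.nat 0 0 = n := by rw [hf.nat 0 (by decide), hn]
    rw [for_exists (fun τ => 0 < τ.nat 6 x)
      (fun j => ∃ k < n, i = x ∧ ((0 < σ.nat 5 (i * n + j) ∧ 0 < σ.nat 5 (i * n + k)) ∧
        j ≠ k ∧ ¬ 0 < σ.nat 5 (j * n + k))) (by decide) (by simp)]
    · rw [hn1, add_zero]
    · intro j hj τ' hτ' hf'
      have hn2 : τ'.nat 0 0 = n := by rw [hf'.nat 0 (by decide), hn1]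
      rw [for_exists (fun τ => 0 < τ.nat 6 x)
        (fun k => i = x ∧ ((0 < σ.nat 5 (i * n + j) ∧ 0 < σ.nat 5 (i * n + k)) ∧
          j ≠ k ∧ ¬ 0 < σ.nat 5 (j * n + k))) (by decide) (by simp)]
      · rw [hn2, add_zero]
      · intro k hk τ'' hτ'' hf''
        rw [mark_pos]
        have e20 : τ''.nat 20 0 = i := by
          rw [hf''.nat 20 (by decide), hf'.nat 20 (by decide), hτ]
        have e21 : τ''.nat 21 0 = j := by rw [hf''.nat 21 (by decide), hτ']
        have e4 : τ''.nat 4 = σ.nat 4 := by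
          rw [hf''.nat 4 (by decide), hf'.nat 4 (by decide), hf.nat 4 (by decide)]
        have e5 : τ''.nat 5 = σ.nat 5 := by
          rw [hf''.nat 5 (by decide), hf'.nat 5 (by decide), hf.nat 5 (by decide)]
        simp only [holds_both, holds_neg, holds_adj, holds_eq, eval_var, e20, e21, hτ'', e4, e5,
          hrow i (by omega), hrow j (by omega), ne_eq]

/-- Mark the vertices of the clique. -/
def clique : LProg :=
  for_ 20 0 0 (for_ 21 0 0 (mark 7 (var 20)
    (or (pos (.cell 6 (var 20)))
      (.both (.both (.natLt (var 21) (var 20)) (adj (var 21) (var 20)))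
        (.neg (pos (.cell 6 (var 21))))))))

theorem clique_spec {n : ℕ} (hn : σ.nat 0 0 = n) (hrow : ∀ u < n, σ.nat 4 u = u * n)
    {G : SimpleGraph (Fin n)} (hadj : ∀ u v : Fin n, 0 < σ.nat 5 (u * n + v) ↔ G.Adj u v)
    (hs : ∀ u : Fin n, 0 < σ.nat 6 u ↔ ¬ IsSimplicialOff G ∅ u)
    (h0 : ∀ j, σ.nat 7 j = 0) (x : Fin n) :
    0 < (clique.den σ).nat 7 x ↔ x ∈ canonicalClique G := by
  unfold clique
  rw [for_exists (fun τ => 0 < τ.nat 7 x)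
    (fun i => ∃ j < n, i = x ∧ (0 < σ.nat 6 i ∨
      ((j < i ∧ 0 < σ.nat 5 (j * n + i)) ∧ ¬ 0 < σ.nat 6 j))) (by decide) (by simp)]
  · rw [h0, hn]
    simp only [lt_irrefl, false_or, add_zero, canonicalClique, Set.mem_ofPred_eq]
    constructor
    · rintro ⟨i, hi, j, hj, rfl, h1 | ⟨⟨h1, h2⟩, h3⟩⟩
      · exact Or.inl ((hs x).1 h1)
      · refine Or.inr ⟨⟨j, hj⟩, h1, (hadj ⟨j, hj⟩ x).1 h2, ?_⟩
        have := (hs ⟨j, hj⟩).2.mt h3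
        exact not_not.1 this
    · rintro (h | ⟨u, hu, h1, h2⟩)
      · exact ⟨x, x.2, x, x.2, rfl, Or.inl ((hs x).2 h)⟩
      · exact ⟨x, x.2, u, u.2, rfl, Or.inr ⟨⟨hu, (hadj u x).2 h1⟩, fun h => (hs u).1 h h2⟩⟩
  · intro i hi τ hτ hf
    have hn1 : τ.nat 0 0 = n := by rw [hf.nat 0 (by decide), hn]
    rw [for_exists (fun τ => 0 < τ.nat 7 x)
      (fun j => i = x ∧ (0 < σ.nat 6 i ∨
        ((j < i ∧ 0 < σ.nat 5 (j * n + i)) ∧ ¬ 0 < σ.nat 6 j))) (by decide) (by simp)]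
    · rw [hn1, add_zero]
    · intro j hj τ' hτ' hf'
      rw [mark_pos]
      have e20 : τ'.nat 20 0 = i := by rw [hf'.nat 20 (by decide), hτ]
      have e4 : τ'.nat 4 = σ.nat 4 := by rw [hf'.nat 4 (by decide), hf.nat 4 (by decide)]
      have e5 : τ'.nat 5 = σ.nat 5 := by rw [hf'.nat 5 (by decide), hf.nat 5 (by decide)]
      have e6 : τ'.nat 6 = σ.nat 6 := by rw [hf'.nat 6 (by decide), hf.nat 6 (by decide)]
      simp only [holds_both, holds_neg, holds_adj, holds_or, holds_pos, holds_natLt, eval_cell,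
        eval_var, e20, hτ', e4, e5, e6, hrow j (by omega)]

/-- The preprocessing. -/
def preprocess : LProg := seq (seq rows matrix) (seq nonsimplicial clique)

/-- The memory contains the graph `G` with a clique `K` and weights `w`. -/
structure Loaded {n : ℕ} (G : SimpleGraph (Fin n)) (K : Set (Fin n)) (w : Fin n → ℝ)
    (σ : Memory) : Prop where
  size : σ.nat 0 0 = n
  row : ∀ u < n, σ.nat 4 u = u * n
  adj : ∀ u v : Fin n, 0 < σ.nat 5 (u * n + v) ↔ G.Adj u v
  clique : ∀ u : Fin n, 0 < σ.nat 7 u ↔ u ∈ K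
  weight : ∀ u : Fin n, σ.wt 0 u = w u

theorem Loaded.frame {n : ℕ} {G : SimpleGraph (Fin n)} {K : Set (Fin n)} {w : Fin n → ℝ}
    {σ τ : Memory} (h : Loaded G K w σ) {p : LProg} (hf : Frame p σ τ)
    (hp : (∀ a ∈ [0, 4, 5, 7], a ∉ p.natWrites) ∧ 0 ∉ p.wtWrites) : Loaded G K w τ := by
  have h0 := hf.nat 0 (hp.1 0 (by decide))
  have h4 := hf.nat 4 (hp.1 4 (by decide))
  have h5 := hf.nat 5 (hp.1 5 (by decide))
  have h7 := hf.nat 7 (hp.1 7 (by decide))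
  have hw := hf.wt 0 hp.2
  exact ⟨by rw [h0]; exact h.size, by rw [h4]; exact h.row, by rw [h5]; exact h.adj,
    by rw [h7]; exact h.clique, by rw [hw]; exact h.weight⟩

theorem preprocess_spec {n : ℕ} {G : SimpleGraph (Fin n)} {es : List (Fin n × Fin n)}
    (hes : IsEdgeList G es) (w : Fin n → ℝ) :
    Loaded G (canonicalClique G) w (preprocess.den (input n es w)) := by
  unfold preprocess
  simp only [den]
  set σ := input n es w
  have f1 := rows.frame σ
  have r1 : ∀ u < n, (rows.den σ).nat 4 u = u * n := fun u hu =>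
    rows_spec rfl rfl hu.le
  set σ1 := rows.den σ
  have f2 := matrix.frame σ1
  have hadj : ∀ u v : Fin n, 0 < (matrix.den σ1).nat 5 (u * n + v) ↔ G.Adj u v := by
    intro u v
    rw [matrix_spec (es := es) r1, hes u v]
    · intro j; rw [f1.nat 5 (by decide)]; rfl
    · rw [f1.nat 0 (by decide)]; rfl
    · intro j hj
      rw [f1.nat 1 (by decide)]
      simp [σ, input, hj]
    · intro j hj
      rw [f1.nat 2 (by decide)]
      simp [σ, input, hj]
  set σ2 := matrix.den σ1
  have r2 : ∀ u < n, σ2.nat 4 u = u * n := by rw [f2.nat 4 (by decide)]; exact r1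
  have n2 : σ2.nat 0 0 = n := by rw [f2.nat 0 (by decide), f1.nat 0 (by decide)]; rfl
  have f3 := nonsimplicial.frame σ2
  have hs := nonsimplicial_spec n2 r2 hadj
    (by intro j; rw [f2.nat 6 (by decide), f1.nat 6 (by decide)]; rfl)
  set σ3 := nonsimplicial.den σ2
  have f4 := clique.frame σ3
  have r3 : ∀ u < n, σ3.nat 4 u = u * n := by rw [f3.nat 4 (by decide)]; exact r2
  have n3 : σ3.nat 0 0 = n := by rw [f3.nat 0 (by decide)]; exact n2
  have a3 : ∀ u v : Fin n, 0 < σ3.nat 5 (u * n + v) ↔ G.Adj u v := by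
    rw [f3.nat 5 (by decide)]; exact hadj
  refine ⟨by rw [f4.nat 0 (by decide)]; exact n3, by rw [f4.nat 4 (by decide)]; exact r3,
    by rw [f4.nat 5 (by decide)]; exact a3, clique_spec n3 r3 a3 hs ?_, ?_⟩
  · intro j
    rw [f3.nat 7 (by decide), f2.nat 7 (by decide), f1.nat 7 (by decide)]; rfl
  · intro u
    rw [f4.wt 0 (by decide), f3.wt 0 (by decide), f2.wt 0 (by decide), f1.wt 0 (by decide)]
    simp [σ, input]

end LProg

end Preprocessing

/-! ### The program: a maximum closure problem -/

section ClosureProgram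

namespace LProg

/-- The memory contains the graph, and the vertices of status `0` are those of `U`. -/
structure Restricted {n : ℕ} (G : SimpleGraph (Fin n)) (K : Set (Fin n)) (w : Fin n → ℝ)
    (U : Finset (Fin n)) (σ : Memory) : Prop extends Loaded G K w σ where
  free : ∀ u : Fin n, σ.nat 8 u = 0 ↔ u ∈ U

/-- The order of a split graph with clique `K`, restricted to `U`. -/
def arcs {n : ℕ} (G : SimpleGraph (Fin n)) (K : Set (Fin n)) (U : Finset (Fin n))
    (u v : Fin n) : Prop :=
  u ∈ U ∧ v ∈ U ∧ prec G K Kᶜ u v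

/-- The state of the push-relabel algorithm that a memory represents. -/
def state (n : ℕ) (σ : Memory) : PState (Fin n) where
  x := fun u v => σ.wt 2 (u * n + v)
  e := fun u => σ.wt 1 u
  d := fun u => σ.nat 9 u

variable {n : ℕ} {G : SimpleGraph (Fin n)} {K : Set (Fin n)} {w : Fin n → ℝ}
  {U : Finset (Fin n)} {σ : Memory}

theorem Restricted.frame {τ : Memory} (h : Restricted G K w U σ) {p : LProg} (hf : Frame p σ τ)
    (hp : (∀ a ∈ [0, 4, 5, 7], a ∉ p.natWrites) ∧ 0 ∉ p.wtWrites) (hp8 : 8 ∉ p.natWrites) :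
    Restricted G K w U τ :=
  ⟨h.toLoaded.frame hf hp, by rw [hf.nat 8 hp8]; exact h.free⟩

theorem state_setNat (σ : Memory) {a : ℕ} (j x : ℕ) (ha : a ≠ 9) :
    state n (σ.setNat a j x) = state n σ := by
  unfold state
  rw [Memory.setNat_nat_ne _ _ _ ha.symm, Memory.setNat_wt]

/-- Reset the state of the push-relabel algorithm. -/
def reset : LProg :=
  for_ 20 0 0 (seq
    (seq (setWt 1 (var 20) (.cell 0 (var 20))) (setNat 9 (var 20) (.const 0)))
    (for_ 21 0 0 (setWt 2 (entry (var 20) (var 21)) .zero)))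

theorem reset_spec (h : Loaded G K w σ) :
    state n (reset.den σ) = ⟨fun _ _ => 0, w, fun _ => 0⟩ := by
  have hn : σ.nat 0 0 + 0 = n := h.size
  have hx : ∀ u v : Fin n, (reset.den σ).wt 2 (u * n + v) = 0 := by
    intro u v
    unfold reset
    refine for_point (fun τ => τ.wt 2 (u * n + v) = 0) (x := u) (by rw [hn]; exact u.2)
      (by decide) (by simp) ?_ ?_
    · intro τ hτ hf
      have hL := h.frame hf (by decide)
      rw [den_seq]
      have hf' := (seq (setWt 1 (var 20) (.cell 0 (var 20)))
        (setNat 9 (var 20) (.const 0))).frame τ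
      set τ' := (seq (setWt 1 (var 20) (.cell 0 (var 20)))
        (setNat 9 (var 20) (.const 0))).den τ
      have e0 : τ'.nat 0 = τ.nat 0 := hf'.nat 0 (by decide)
      have e4 : τ'.nat 4 = τ.nat 4 := hf'.nat 4 (by decide)
      have e20 : τ'.nat 20 = τ.nat 20 := hf'.nat 20 (by decide)
      refine for_point (σ := τ') (fun τ => τ.wt 2 (u * n + v) = 0) (x := v)
        (by rw [e0, hL.size]; exact v.2) (by decide) (by simp) ?_ ?_
      · intro τ'' hτ'' hf''
        have e4' : τ''.nat 4 = τ.nat 4 := by rw [hf''.nat 4 (by decide), e4]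
        have e20' : τ''.nat 20 = τ.nat 20 := by rw [hf''.nat 20 (by decide), e20]
        simp [den, hτ'', e4', e20', hτ, hL.row]
      · intro j hj hjv τ'' hτ'' hf'' hP
        simp only [den, Memory.setWt_wt, wEval_zero]
        split_ifs
        · rfl
        · exact hP
    · intro i hi hiu τ hτ hf hP
      rw [den_seq]
      refine for_preserves (fun τ => τ.wt 2 (u * n + v) = 0) (by decide) (by simp) ?_ ?_
      · intro j hj τ'' hτ'' hf'' hP
        simp only [den, Memory.setWt_wt, wEval_zero]
        split_ifs
        · rfl
        · exact hP
      · simpa [den] using hP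
  have he : ∀ u : Fin n, (reset.den σ).wt 1 u = w u := by
    intro u
    unfold reset
    refine for_point (fun τ => τ.wt 1 u = w u) (x := u) (by rw [hn]; exact u.2)
      (by decide) (by simp) ?_ ?_
    · intro τ hτ hf
      have hL := h.frame hf (by decide)
      rw [den, den_wt _ _ (by decide)]
      simp [den, hτ, hL.weight]
    · intro i hi hiu τ hτ hf hP
      rw [den, den_wt _ _ (by decide)]
      simpa [den, hτ, Ne.symm hiu] using hP
  have hd : ∀ u : Fin n, (reset.den σ).nat 9 u = 0 := by
    intro u
    unfold reset
    refine for_point (fun τ => τ.nat 9 u = 0) (x := u) (by rw [hn]; exact u.2)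
      (by decide) (by simp) ?_ ?_
    · intro τ hτ hf
      rw [den, den_nat _ _ (by decide)]
      simp [den, hτ]
    · intro i hi hiu τ hτ hf hP
      rw [den, den_nat _ _ (by decide)]
      simpa [den, hτ, Ne.symm hiu] using hP
  exact PState.ext (funext fun u => funext fun v => hx u v) (funext he) (funext hd)

/-- The test for `u` to be active. -/
def active (u : NExp) : Test :=
  .both (.wtLt .zero (.cell 1 u)) (.natLt (.cell 9 u) (.plus (var 0) (.const 1)))

/-- The test for an arc from `u` to `v`. -/
def isArc (u v : NExp) : Test :=
  .both (.both (eq (.cell 8 u) (.const 0)) (eq (.cell 8 v) (.const 0)))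
    (.both (.both (pos (.cell 7 u)) (.neg (pos (.cell 7 v)))) (adj u v))

/-- Push from vertex `nat 20 0` to vertex `nat 21 0`. -/
def push : LProg :=
  ite (.both (active (var 20)) (eq (.cell 9 (var 20)) (.plus (.cell 9 (var 21)) (.const 1))))
    (ite (isArc (var 20) (var 21))
      (seq (setWt 2 (entry (var 20) (var 21))
          (.plus (.cell 2 (entry (var 20) (var 21))) (.cell 1 (var 20))))
        (seq (setWt 1 (var 21) (.plus (.cell 1 (var 21)) (.cell 1 (var 20))))
          (setWt 1 (var 20) (.minus (.cell 1 (var 20)) (.cell 1 (var 20))))))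
      (ite (.wtLt .zero (.cell 2 (entry (var 21) (var 20))))
        (ite (.wtLt (.cell 1 (var 20)) (.cell 2 (entry (var 21) (var 20))))
          (seq (setWt 2 (entry (var 21) (var 20))
              (.minus (.cell 2 (entry (var 21) (var 20))) (.cell 1 (var 20))))
            (seq (setWt 1 (var 21) (.plus (.cell 1 (var 21)) (.cell 1 (var 20))))
              (setWt 1 (var 20) (.minus (.cell 1 (var 20)) (.cell 1 (var 20))))))
          (seq (setWt 1 (var 21) (.plus (.cell 1 (var 21))
              (.cell 2 (entry (var 21) (var 20)))))
            (seq (setWt 1 (var 20) (.minus (.cell 1 (var 20))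
                (.cell 2 (entry (var 21) (var 20)))))
              (setWt 2 (entry (var 21) (var 20)) (.minus (.cell 2 (entry (var 21) (var 20)))
                (.cell 2 (entry (var 21) (var 20))))))))
        skip))
    skip

theorem holds_active (h : Loaded G K w σ) (u : Fin n) {a : NExp} (ha : a.eval σ = u) :
    (active a).Holds σ ↔ (state n σ).Active (n + 1) u := by
  simp [active, PState.Active, state, ha, h.size]

theorem holds_isArc (h : Restricted G K w U σ) (u v : Fin n) {a b : NExp} (ha : a.eval σ = u)
    (hb : b.eval σ = v) : (isArc a b).Holds σ ↔ arcs G K U u v := by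
  simp only [isArc, arcs, prec, holds_both, holds_neg, holds_pos, holds_eq, holds_adj, eval_cell,
    eval_const, ha, hb, h.free, h.clique, h.row _ u.2, h.adj, Set.mem_compl_iff]
  tauto

/-- In each branch the cell that supplies the pushed amount is overwritten last. The labels of `u`
and `v` differ, so their excess cells are distinct. -/
theorem push_spec (h : Restricted G K w U σ) (u v : Fin n) (hu : σ.nat 20 0 = u)
    (hv : σ.nat 21 0 = v) :
    state n (push.den σ) = (state n σ).push (arcs G K U) (n + 1) u v := by
  classical
  have hu' := h.row _ u.2
  have hv' := h.row _ v.2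
  have t1 : (Test.both (active (var 20))
      (eq (.cell 9 (var 20)) (.plus (.cell 9 (var 21)) (.const 1)))).Holds σ ↔
      (state n σ).Active (n + 1) u ∧ (state n σ).d u = (state n σ).d v + 1 := by
    rw [holds_both, holds_active h.toLoaded u (a := var 20) hu]
    simp [hu, hv, state]
  have t2 := holds_isArc h u v (a := var 20) (b := var 21) hu hv
  have t3 : (Test.wtLt .zero (.cell 2 (entry (var 21) (var 20)))).Holds σ ↔
      0 < (state n σ).x v u := by
    simp [hu, hv, hv', state]
  have t4 : (Test.wtLt (.cell 1 (var 20)) (.cell 2 (entry (var 21) (var 20)))).Holds σ ↔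
      (state n σ).e u < (state n σ).x v u := by
    simp [hu, hv, hv', state]
  simp only [push, den, PState.push, t1, t2, t3, t4]
  by_cases c1 : (state n σ).Active (n + 1) u ∧ (state n σ).d u = (state n σ).d v + 1
  swap
  · rw [if_neg c1, if_neg c1]
  have huv := PState.ne_of_label_eq c1.2
  have huv' : (u : ℕ) ≠ v := fun hh => huv (Fin.ext hh)
  rw [if_pos c1, if_pos c1]
  by_cases c2 : arcs G K U u v
  · rw [if_pos c2, if_pos c2]
    ext p q
    · simp [state, PState.shift, hu, hv, hu', pair_inj, Fin.val_inj]
      split_ifs with hc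
      · rw [hc.1, hc.2]
      · rfl
    · by_cases hpu : p = u
      · simp [state, PState.shift, hu, hv, hpu, huv']
      · by_cases hpv : p = v
        · simp [state, PState.shift, hu, hv, hpv, huv.symm, huv'.symm]
        · simp [state, PState.shift, hu, hv, hpu, hpv, Fin.val_inj]
    · simp [state, PState.shift]
  rw [if_neg c2, if_neg c2]
  by_cases c3 : 0 < (state n σ).x v u
  swap
  · rw [if_neg c3, if_neg c3]
  rw [if_pos c3, if_pos c3]
  by_cases c4 : (state n σ).e u < (state n σ).x v u
  · rw [if_pos c4, if_pos c4]
    ext p q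
    · simp [state, PState.shift, hu, hv, hv', pair_inj, Fin.val_inj]
      split_ifs with hc
      · rw [hc.1, hc.2]; ring
      · rfl
    · by_cases hpu : p = u
      · simp [state, PState.shift, hu, hv, hpu, huv', huv]
      · by_cases hpv : p = v
        · simp [state, PState.shift, hu, hv, hpv, huv'.symm]
        · simp [state, PState.shift, hu, hv, hpu, hpv, Fin.val_inj]
    · simp [state, PState.shift]
  · rw [if_neg c4, if_neg c4]
    ext p q
    · simp [state, PState.shift, hu, hv, hv', pair_inj, Fin.val_inj]
      split_ifs with hc
      · rw [hc.1, hc.2]; ring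
      · rfl
    · by_cases hpu : p = u
      · simp [state, PState.shift, hu, hv, hv', hpu, huv', huv]
        ring
      · by_cases hpv : p = v
        · simp [state, PState.shift, hu, hv, hv', hpv, huv'.symm]
        · simp [state, PState.shift, hu, hv, hpu, hpv, Fin.val_inj]
    · simp [state, PState.shift]

/-- Increase the label of vertex `nat 20 0` if it is active. -/
def relabel : LProg :=
  ite (active (var 20)) (setNat 9 (var 20) (.plus (.cell 9 (var 20)) (.const 1))) skip

theorem relabel_spec (h : Loaded G K w σ) (u : Fin n) (hu : σ.nat 20 0 = u) :
    state n (relabel.den σ) = (state n σ).relabel (n + 1) u := by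
  classical
  have t1 := holds_active h u (a := var 20) hu
  simp only [relabel, den, PState.relabel, t1]
  split_ifs with c1
  · ext p q
    · simp [state]
    · simp [state]
    · simp only [state, Memory.setNat_nat, eval_var, eval_plus, eval_cell, eval_const, hu,
        true_and, Fin.val_inj]
      split_ifs with hc
      · rw [hc]
      · rfl
  · rfl

/-- Push from vertex `nat 20 0` to all vertices, then relabel it if it is still active. -/
def discharge : LProg := seq (for_ 21 0 0 push) relabel

/-- After the pushes to the vertices below `i`, no residual arc from a still active `u` to these
vertices descends: each push clears its own arc, and later ones create no residual arc out of `u`.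
Hence the relabelling is valid. An active `u` is either pushed from or relabelled, so the measure
drops. -/
theorem discharge_spec (h : Restricted G K w U σ) (u : Fin n) (hu : σ.nat 20 0 = u)
    (hI : (state n σ).Inv (arcs G K U) (n + 1) w) :
    (state n (discharge.den σ)).Inv (arcs G K U) (n + 1) w ∧
      ((¬ (state n σ).Active (n + 1) u ∧ state n (discharge.den σ) = state n σ) ∨
        ((state n σ).Active (n + 1) u ∧
          (state n (discharge.den σ)).measure (n + 1) < (state n σ).measure (n + 1))) := by
  set s₀ := state n σ
  have key := for_induction (v := 21) (b := 0) (k := 0) (p := push) (σ := σ)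
    (fun (i : ℕ) (τ : Memory) => (state n τ).Inv (arcs G K U) (n + 1) w ∧
      (state n τ = s₀ ∨
        (s₀.Active (n + 1) u ∧ (state n τ).measure (n + 1) < s₀.measure (n + 1))) ∧
      ∀ v : Fin n, (v : ℕ) < i → (state n τ).Active (n + 1) u →
        (state n τ).Residual (arcs G K U) u v → (state n τ).d u ≤ (state n τ).d v)
    (by decide) ?_ ?_
  rotate_left
  · rw [state_setNat _ _ _ (by decide)]
    exact ⟨hI, Or.inl rfl, fun v hv => by omega⟩
  · intro i hi τ hτ hf hJ
    obtain ⟨h1, h2, h3⟩ := hJ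
    rw [add_zero, h.size] at hi
    rw [state_setNat _ _ _ (by decide), push_spec (h.frame hf (by decide) (by decide)) u ⟨i, hi⟩
      (by rw [hf.nat 20 (by decide), hu]) hτ]
    refine ⟨h1.push _ _, ?_, ?_⟩
    · rcases PState.measure_push h1 u ⟨i, hi⟩ with h4 | h4
      · rw [h4]; exact h2
      · rcases h2 with h2 | h2
        · by_cases hact : s₀.Active (n + 1) u
          · right
            exact ⟨hact, by rw [← h2]; exact h4⟩
          · rw [h2, PState.push_of_not_active hact]
            exact Or.inl rfl
        · exact Or.inr ⟨h2.1, h4.trans h2.2⟩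
    · intro v hv hact hres
      rw [PState.push_d]
      by_cases hvi : v = ⟨i, hi⟩
      · rw [hvi] at hres ⊢
        exact PState.push_clears hact hres h1
      · refine h3 v ?_ (PState.active_of_push hact) (PState.residual_of_push hvi hres)
        have : (v : ℕ) ≠ i := fun hh => hvi (Fin.ext hh)
        omega
  have hf := (for_ 21 0 0 push).frame σ
  simp only [discharge, den_seq]
  set τ := (for_ 21 0 0 push).den σ
  obtain ⟨h1, h2, h3⟩ := key
  have h3 : ∀ v : Fin n, _ := fun v => h3 v (by rw [add_zero, h.size]; exact v.2)
  rw [relabel_spec (h.toLoaded.frame hf (by decide)) u (by rw [hf.nat 20 (by decide), hu])]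
  have h4 := h1.relabel (u := u) (fun hact v hres => h3 v hact hres)
  refine ⟨h4, ?_⟩
  by_cases hact : (state n τ).Active (n + 1) u
  · have h5 := PState.measure_relabel h4 hact
    rcases h2 with h2 | h2
    · rw [h2] at h5 hact ⊢
      exact Or.inr ⟨hact, h5⟩
    · exact Or.inr ⟨h2.1, h5.trans h2.2⟩
  · have h5 : (state n τ).relabel (n + 1) u = state n τ := by
      unfold PState.relabel
      rw [if_neg hact]
    rw [h5]
    rcases h2 with h2 | h2
    · rw [h2] at hact ⊢
      exact Or.inl ⟨hact, rfl⟩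
    · exact Or.inr h2

/-- Discharge all vertices. -/
def round : LProg := for_ 20 0 0 discharge

theorem round_spec (h : Restricted G K w U σ)
    (hI : (state n σ).Inv (arcs G K U) (n + 1) w) :
    (state n (round.den σ)).Inv (arcs G K U) (n + 1) w ∧
      (((∀ u, ¬ (state n σ).Active (n + 1) u) ∧ state n (round.den σ) = state n σ) ∨
        ((∃ u, (state n σ).Active (n + 1) u) ∧
          (state n (round.den σ)).measure (n + 1) < (state n σ).measure (n + 1))) := by
  set s₀ := state n σ
  have key := for_induction (v := 20) (b := 0) (k := 0) (p := discharge) (σ := σ)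
    (fun (i : ℕ) (τ : Memory) => (state n τ).Inv (arcs G K U) (n + 1) w ∧
      (((∀ u : Fin n, (u : ℕ) < i → ¬ s₀.Active (n + 1) u) ∧ state n τ = s₀) ∨
        ((∃ u, s₀.Active (n + 1) u) ∧ (state n τ).measure (n + 1) < s₀.measure (n + 1))))
    (by decide) ?_ ?_
  rotate_left
  · rw [state_setNat _ _ _ (by decide)]
    exact ⟨hI, Or.inl ⟨fun u hu => by omega, rfl⟩⟩
  · intro i hi τ hτ hf hJ
    obtain ⟨h1, h2⟩ := hJ
    rw [add_zero, h.size] at hi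
    rw [state_setNat _ _ _ (by decide)]
    obtain ⟨h3, h4⟩ := discharge_spec (h.frame hf (by decide) (by decide)) ⟨i, hi⟩ hτ h1
    refine ⟨h3, ?_⟩
    rcases h4 with ⟨h4, h5⟩ | ⟨h4, h5⟩
    · rw [h5]
      rcases h2 with ⟨h2, h6⟩ | h2
      · rw [h6] at h4
        refine Or.inl ⟨fun u hui => ?_, h6⟩
        by_cases hu : u = ⟨i, hi⟩
        · rw [hu]; exact h4
        · have : (u : ℕ) ≠ i := fun hh => hu (Fin.ext hh)
          exact h2 u (by omega)
      · exact Or.inr h2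
    · rcases h2 with ⟨h2, h6⟩ | h2
      · rw [h6] at h4 h5
        exact Or.inr ⟨⟨_, h4⟩, h5⟩
      · exact Or.inr ⟨h2.1, h5.trans h2.2⟩
  refine ⟨key.1, ?_⟩
  rcases key.2 with h1 | h1
  · exact Or.inl ⟨fun u => h1.1 u (by rw [add_zero, h.size]; exact u.2), h1.2⟩
  · exact Or.inr h1

/-- Repeat a program `(n + 1) ^ k` times by `k` nested loops. -/
def nest (p : LProg) : ℕ → LProg
  | 0 => p
  | k + 1 => for_ (24 + k) 0 1 (nest p k)

theorem mem_natWrites_nest {p : LProg} {a : ℕ} (k : ℕ) (h : a ∈ (nest p k).natWrites) :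
    a ∈ p.natWrites ∨ 24 ≤ a ∧ a < 24 + k := by
  induction k with
  | zero => exact Or.inl h
  | succ k ih =>
    rcases List.mem_cons.1 h with h | h
    · exact Or.inr (by omega)
    · rcases ih h with h | h
      · exact Or.inl h
      · exact Or.inr (by omega)

/-- The index of `Q` is fuel: one execution of `p` uses one unit, and `k` nested loops of `n + 1`
rounds use `(n + 1) ^ k`. -/
theorem nest_spec {p : LProg} (Q : ℕ → Memory → Prop)
    (hp : ∀ m τ, Q (m + 1) τ → Q m (p.den τ)) (hn : ∀ m τ, Q m τ → τ.nat 0 0 = n)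
    (hQ : ∀ a m τ x, 24 ≤ a → Q m τ → Q m (τ.setNat a 0 x)) (hw : ∀ k, 24 + k ∉ p.natWrites)
    (k m : ℕ) (τ : Memory) (h : Q (m + (n + 1) ^ k) τ) : Q m ((nest p k).den τ) := by
  induction k generalizing m τ with
  | zero => exact hp m τ (by simpa using h)
  | succ k ih =>
    have h0 := hn _ _ h
    have key := for_induction (v := 24 + k) (b := 0) (k := 1) (p := nest p k) (σ := τ)
      (fun i τ' => Q (m + (n + 1 - i) * (n + 1) ^ k) τ') ?_ ?_ ?_
    · rw [h0, Nat.sub_self, Nat.zero_mul, Nat.add_zero] at key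
      exact key
    · intro hmem
      rcases mem_natWrites_nest k hmem with h | h
      · exact hw k h
      · omega
    · refine hQ _ _ _ _ (by omega) ?_
      rw [Nat.sub_zero, ← pow_succ']
      exact h
    · intro i hi τ' _ _ hJ
      refine hQ _ _ _ _ (by omega) (ih _ _ ?_)
      rw [h0] at hi
      rw [show n + 1 - i = (n + 1 - (i + 1)) + 1 by omega, Nat.succ_mul] at hJ
      rw [Nat.add_assoc]
      exact hJ

/-- Solve the closure problem by push-relabel. -/
def pushRelabel : LProg := seq reset (nest round 6)

theorem pushRelabel_spec (h : Restricted G K w U σ) :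
    (state n (pushRelabel.den σ)).Inv (arcs G K U) (n + 1) w ∧
      ∀ u, ¬ (state n (pushRelabel.den σ)).Active (n + 1) u := by
  have hI : (state n (reset.den σ)).Inv (arcs G K U) (n + 1) w := by
    rw [reset_spec h.toLoaded]
    exact PState.inv_initial _ _ _
  have hR : Restricted G K w U (reset.den σ) :=
    h.frame (reset.frame σ) (by decide) (by decide)
  -- Either the algorithm has stopped or the measure is below the remaining fuel; at fuel 0 only the
  -- first is possible.
  have key := nest_spec (n := n) (p := round) (fun m τ => Restricted G K w U τ ∧
    (state n τ).Inv (arcs G K U) (n + 1) w ∧ ((∀ u, ¬ (state n τ).Active (n + 1) u) ∨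
      (state n τ).measure (n + 1) < m)) ?_ ?_ ?_ ?_ 6 0 (reset.den σ) ?_
  · obtain ⟨-, h1, h2⟩ := key
    refine ⟨h1, h2.resolve_right (by omega)⟩
  · rintro m τ ⟨h1, h2, h3⟩
    obtain ⟨h4, h5⟩ := round_spec h1 h2
    refine ⟨h1.frame (round.frame τ) (by decide) (by decide), h4, ?_⟩
    rcases h5 with ⟨h5, h6⟩ | ⟨⟨u, h5⟩, h6⟩
    · rw [h6]; exact Or.inl h5
    · rcases h3 with h3 | h3
      · exact absurd h5 (h3 u)
      · exact Or.inr (by omega)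
  · rintro m τ ⟨h1, -⟩
    exact h1.size
  · rintro a m τ x ha ⟨h1, h2⟩
    rw [state_setNat _ _ _ (by omega)]
    refine ⟨h1.frame (p := setNat a (.const 0) (.const x)) (frame _ τ) ?_ ?_, h2⟩
    · simp only [natWrites, wtWrites, List.mem_cons, List.not_mem_nil,
        not_false_eq_true, and_true, or_false]
      omega
    · simp only [natWrites, List.mem_singleton]
      omega
  · intro k hk
    have : ∀ a ∈ round.natWrites, a < 24 := by decide
    have := this _ hk
    omega
  · refine ⟨hR, hI, Or.inr ?_⟩
    have := PState.measure_lt (s := state n (reset.den σ)) (by simpa using hI.bound)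
    simpa using this

/-- Find a label that does not occur. -/
def gap : LProg :=
  for_ 22 0 1 (seq
    (seq (setNat 11 (.const 0) (.const 0))
      (for_ 20 0 0 (mark 11 (.const 0) (eq (.cell 9 (var 20)) (.plus (var 22) (.const 1))))))
    (ite (pos (var 11)) skip (setNat 10 (.const 0) (.plus (var 22) (.const 1)))))

theorem gap_spec (hn : σ.nat 0 0 = n) :
    (gap.den σ).nat 10 0 ≤ n + 1 ∧
      ∀ v : Fin n, (state n (gap.den σ)).d v ≠ (gap.den σ).nat 10 0 := by
  have hd : (state n (gap.den σ)).d = (state n σ).d := by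
    unfold state
    rw [gap.den_nat σ (by decide)]
  rw [hd]
  -- Cell `10` may hold a value from an earlier problem. If that value happens to be a missing label
  -- it is as good as any other; `exists_gap` supplies one in any case.
  refine (for_exists (fun τ => τ.nat 10 0 ≤ n + 1 ∧ ∀ v : Fin n, (state n σ).d v ≠ τ.nat 10 0)
    (fun i => ∀ v, (state n σ).d v ≠ i + 1) (by decide) (by simp) ?_).2 (Or.inr ?_)
  · intro i hi τ hτ hf
    have e1 : ∀ τ', 0 < ((for_ 20 0 0 (mark 11 (.const 0)
        (eq (.cell 9 (var 20)) (.plus (var 22) (.const 1))))).den τ').nat 11 0 ↔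
        0 < τ'.nat 11 0 ∨ ∃ j < τ'.nat 0 0 + 0, τ'.nat 9 j = τ'.nat 22 0 + 1 := by
      intro τ'
      rw [for_exists (fun τ => 0 < τ.nat 11 0) (fun j => τ'.nat 9 j = τ'.nat 22 0 + 1)
        (by decide) (by simp)]
      intro j hj τ'' hτ'' hf''
      rw [mark_pos]
      simp [hτ'', hf''.nat 9 (by decide), hf''.nat 22 (by decide)]
    have hf1 := (seq (setNat 11 (.const 0) (.const 0))
      (for_ 20 0 0 (mark 11 (.const 0)
        (eq (.cell 9 (var 20)) (.plus (var 22) (.const 1)))))).frame τ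
    have e2 : 0 < ((seq (setNat 11 (.const 0) (.const 0))
      (for_ 20 0 0 (mark 11 (.const 0)
        (eq (.cell 9 (var 20)) (.plus (var 22) (.const 1)))))).den τ).nat 11 0 ↔
        ¬ ∀ v, (state n σ).d v ≠ i + 1 := by
      rw [den, e1]
      simp only [den, Memory.setNat_nat, eval_const, and_self, if_true, lt_irrefl, false_or,
        (by decide : (0 : ℕ) ≠ 11), (by decide : (9 : ℕ) ≠ 11), (by decide : (22 : ℕ) ≠ 11),
        false_and, if_false, hτ, hf.nat 0 (by decide), hf.nat 9 (by decide), hn, add_zero, state]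
      push Not
      constructor
      · rintro ⟨j, hj, h⟩; exact ⟨⟨j, hj⟩, h⟩
      · rintro ⟨v, h⟩; exact ⟨v, v.2, h⟩
    rw [den_seq]
    set τ' := (seq (setNat 11 (.const 0) (.const 0))
      (for_ 20 0 0 (mark 11 (.const 0)
        (eq (.cell 9 (var 20)) (.plus (var 22) (.const 1)))))).den τ
    have e10 : τ'.nat 10 = τ.nat 10 := hf1.nat 10 (by decide)
    have e22 : τ'.nat 22 0 = i := by rw [hf1.nat 22 (by decide), hτ]
    rw [den, holds_pos, eval_var, e2, den, den]
    by_cases hc : ∀ v, (state n σ).d v ≠ i + 1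
    · rw [if_neg (not_not.2 hc)]
      simp only [Memory.setNat_nat, eval_const, and_self, if_true, eval_plus, eval_var, e22]
      exact ⟨fun _ => Or.inr hc, fun _ => ⟨by omega, hc⟩⟩
    · rw [if_pos hc, e10]
      tauto
  · obtain ⟨l, hl, hl'⟩ := PState.exists_gap (state n σ).d
    rw [Fintype.card_fin] at hl
    exact ⟨l, by rw [hn]; exact hl, hl'⟩

/-- The program for the closure problem finds a maximum-weight filter. -/
theorem closure_spec (h : Restricted G K w U σ) {H : Finset (Fin n)}
    (hH : ∀ v, v ∈ H ↔ v ∈ U ∧ ((seq pushRelabel gap).den σ).nat 10 0 <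
      ((seq pushRelabel gap).den σ).nat 9 v) :
    IsMaxWeight (filters (prec G K Kᶜ) U) w H := by
  obtain ⟨h1, h2⟩ := pushRelabel_spec h
  have hR := h.frame (pushRelabel.frame σ) (by decide) (by decide)
  rw [den_seq] at hH
  set τ := pushRelabel.den σ
  obtain ⟨h3, h4⟩ := gap_spec hR.size
  have hs : state n (gap.den τ) = state n τ := by
    have hf := gap.frame τ
    unfold state
    rw [hf.nat 9 (by decide), hf.wt 1 (by decide), hf.wt 2 (by decide)]
  rw [hs] at h4
  refine PState.Inv.isMaxWeight_filter (r := arcs G K U) (s := state n τ) (fun _ _ => Iff.rfl)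
    h1 h2 h3 h4 ?_
  rw [← hs]
  exact hH

end LProg

end ClosureProgram

/-! ### The program: all closure problems -/

section MainProgram

namespace LProg

variable {n : ℕ} {G : SimpleGraph (Fin n)} {K : Set (Fin n)} {w : Fin n → ℝ} {σ : Memory}

/-- The test for `nat 23 0` to be a vertex of the independent set. -/
def special : Test := .both (.natLt (var 23) (var 0)) (.neg (pos (.cell 7 (var 23))))

/-- The test for vertex `nat 20 0` to be in the forced set of vertex `nat 23 0`, as witnessed by
vertex `nat 21 0`. -/
def forced : Test :=
  .both special (or (.both (pos (.cell 7 (var 20))) (.neg (adj (var 20) (var 23))))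
    (.both (.neg (pos (.cell 7 (var 20))))
      (.both (adj (var 20) (var 21)) (.neg (adj (var 23) (var 21))))))

/-- Compute the status of the vertices: `0` for the elements of the closure problem, `1` for the
forced vertices, and `2` for the excluded vertex. -/
def status : LProg :=
  for_ 20 0 0 (seq
    (seq (setNat 8 (var 20) (.const 0)) (for_ 21 0 0 (mark 8 (var 20) forced)))
    (ite (.both special (eq (var 20) (var 23))) (setNat 8 (var 20) (.const 2)) skip))

/-! ### Recognizing the forced and the free vertices -/

theorem holds_special (h : Loaded G K w σ) :
    special.Holds σ ↔ ∃ i : Fin n, (i : ℕ) = σ.nat 23 0 ∧ i ∉ K := by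
  simp only [special, holds_both, holds_natLt, holds_neg, holds_pos, eval_cell, eval_var, h.size]
  constructor
  · rintro ⟨h1, h2⟩
    exact ⟨⟨_, h1⟩, rfl, fun hK => h2 ((h.clique ⟨_, h1⟩).2 hK)⟩
  · rintro ⟨i, hi, hiK⟩
    rw [← hi]
    exact ⟨i.2, fun hK => hiK ((h.clique i).1 hK)⟩

theorem holds_forced (h : Loaded G K w σ) (x v : Fin n) (hx : σ.nat 20 0 = x)
    (hv : σ.nat 21 0 = v) :
    forced.Holds σ ↔ ∃ i : Fin n, (i : ℕ) = σ.nat 23 0 ∧ i ∉ K ∧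
      ((x ∈ K ∧ ¬ G.Adj x i) ∨ (x ∉ K ∧ G.Adj x v ∧ ¬ G.Adj i v)) := by
  rw [forced, holds_both, holds_special h]
  simp only [holds_or, holds_both, holds_pos, holds_neg, holds_adj, eval_cell, eval_var, hx, hv,
    h.clique, h.row _ x.2]
  constructor
  · rintro ⟨⟨i, hi, hiK⟩, h1⟩
    rw [← hi, h.adj, h.row _ i.2, h.adj, h.adj] at h1
    exact ⟨i, hi, hiK, h1⟩
  · rintro ⟨i, hi, hiK, h1⟩
    rw [← hi, h.adj, h.row _ i.2, h.adj, h.adj]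
    exact ⟨⟨i, rfl, hiK⟩, h1⟩

/-- Code 2 is written after the marks of forced vertices, so that the excluded vertex counts neither
as free nor as forced. If `nat 23 0` is not an independent vertex, all codes are 0 and the problem
is the unrestricted one. -/
theorem status_spec (h : Loaded G K w σ) (x : Fin n) :
    (status.den σ).nat 8 x ≤ 2 ∧
      ((status.den σ).nat 8 x = 2 ↔ ∃ i : Fin n, (i : ℕ) = σ.nat 23 0 ∧ i ∉ K ∧ x = i) ∧
      (0 < (status.den σ).nat 8 x ↔ ∃ i : Fin n, (i : ℕ) = σ.nat 23 0 ∧ i ∉ K ∧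
        (x = i ∨ x ∈ fos G K Kᶜ i)) := by
  unfold status
  refine for_point (fun τ => τ.nat 8 x ≤ 2 ∧
    (τ.nat 8 x = 2 ↔ ∃ i : Fin n, (i : ℕ) = σ.nat 23 0 ∧ i ∉ K ∧ x = i) ∧
      (0 < τ.nat 8 x ↔ ∃ i : Fin n, (i : ℕ) = σ.nat 23 0 ∧ i ∉ K ∧
        (x = i ∨ x ∈ fos G K Kᶜ i))) (x := x) (by rw [h.size]; exact x.2) (by decide)
    (by simp) ?_ ?_
  · intro τ hτ hf
    have hL := h.frame hf (by decide)
    have h23 : τ.nat 23 0 = σ.nat 23 0 := by rw [hf.nat 23 (by decide)]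
    rw [den_seq, den_seq]
    have hf0 := (setNat 8 (var 20) (.const 0)).frame τ
    have e8 : ((setNat 8 (var 20) (.const 0)).den τ).nat 8 x = 0 := by simp [den, hτ]
    set τ₀ := (setNat 8 (var 20) (.const 0)).den τ
    have hL0 := hL.frame hf0 (by decide)
    have hτ0 : τ₀.nat 20 0 = x := by rw [hf0.nat 20 (by decide), hτ]
    have h230 : τ₀.nat 23 0 = σ.nat 23 0 := by rw [hf0.nat 23 (by decide), h23]
    have hf1 := (for_ 21 0 0 (mark 8 (var 20) forced)).frame τ₀
    have e1 : ((for_ 21 0 0 (mark 8 (var 20) forced)).den τ₀).nat 8 x ≤ 1 := by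
      refine for_preserves (fun τ => τ.nat 8 x ≤ 1) (by decide) (by simp) ?_ (by omega)
      intro i hi τ' hτ' hf' hP
      simp only [mark, den]
      split_ifs
      · simp only [Memory.setNat_nat, eval_const]
        split_ifs
        · exact le_rfl
        · exact hP
      · exact hP
    have e2 : 0 < ((for_ 21 0 0 (mark 8 (var 20) forced)).den τ₀).nat 8 x ↔
        ∃ i : Fin n, (i : ℕ) = σ.nat 23 0 ∧ i ∉ K ∧ x ∈ fos G K Kᶜ i := by
      rw [for_exists (fun τ => 0 < τ.nat 8 x) (fun j => ∃ v : Fin n, (v : ℕ) = j ∧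
        ∃ i : Fin n, (i : ℕ) = σ.nat 23 0 ∧ i ∉ K ∧
          ((x ∈ K ∧ ¬ G.Adj x i) ∨ (x ∉ K ∧ G.Adj x v ∧ ¬ G.Adj i v))) (by decide) (by simp)]
      · rw [e8, hL0.size]
        simp only [lt_irrefl, false_or, mem_fos, Set.mem_compl_iff]
        constructor
        · rintro ⟨j, hj, v, rfl, i, hi, hiK, h1 | h1⟩
          · exact ⟨i, hi, hiK, Or.inl h1⟩
          · exact ⟨i, hi, hiK, Or.inr ⟨h1.1, fun hs => h1.2.2 (hs h1.2.1)⟩⟩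
        · rintro ⟨i, hi, hiK, h1 | ⟨h1, h2⟩⟩
          · exact ⟨x, x.2, x, rfl, i, hi, hiK, Or.inl h1⟩
          · obtain ⟨v, hv, hv'⟩ := Set.not_subset.1 h2
            exact ⟨v, v.2, v, rfl, i, hi, hiK, Or.inr ⟨h1, hv, hv'⟩⟩
      · intro j hj τ' hτ' hf'
        rw [add_zero, hL0.size] at hj
        rw [mark_pos, holds_forced (hL0.frame hf' (by decide)) x ⟨j, hj⟩
          (by rw [hf'.nat 20 (by decide), hτ0]) hτ', hf'.nat 23 (by decide), h230, eval_var,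
          hf'.nat 20 (by decide), hτ0]
        refine or_congr_right ⟨fun hh => ⟨⟨j, hj⟩, rfl, hh.2⟩, ?_⟩
        rintro ⟨v, rfl, hv⟩
        exact ⟨rfl, hv⟩
    set τ₁ := (for_ 21 0 0 (mark 8 (var 20) forced)).den τ₀
    have hL1 := hL0.frame hf1 (by decide)
    have hτ1 : τ₁.nat 20 0 = x := by rw [hf1.nat 20 (by decide), hτ0]
    have h231 : τ₁.nat 23 0 = σ.nat 23 0 := by rw [hf1.nat 23 (by decide), h230]
    have e3 : (Test.both special (eq (var 20) (var 23))).Holds τ₁ ↔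
        ∃ i : Fin n, (i : ℕ) = σ.nat 23 0 ∧ i ∉ K ∧ x = i := by
      rw [holds_both, holds_special hL1, holds_eq, eval_var, eval_var, hτ1, h231]
      constructor
      · rintro ⟨⟨i, hi, hiK⟩, h1⟩
        exact ⟨i, hi, hiK, Fin.ext (h1.trans hi.symm)⟩
      · rintro ⟨i, hi, hiK, rfl⟩
        exact ⟨⟨x, hi, hiK⟩, hi⟩
    rw [den]
    by_cases hc : (Test.both special (eq (var 20) (var 23))).Holds τ₁
    · rw [if_pos hc]
      rw [e3] at hc
      simp only [den, Memory.setNat_nat, eval_var, eval_const, hτ1, and_self, if_true, le_refl,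
        true_and, hc, Nat.succ_pos, true_iff]
      obtain ⟨i, hi, hiK, hx⟩ := hc
      exact ⟨i, hi, hiK, Or.inl hx⟩
    · rw [if_neg hc]
      rw [e3] at hc
      simp only [den]
      refine ⟨by omega, ⟨fun _ => by omega, fun hh => absurd hh hc⟩, ?_⟩
      rw [e2]
      constructor
      · rintro ⟨i, hi, hiK, h1⟩
        exact ⟨i, hi, hiK, Or.inr h1⟩
      · rintro ⟨i, hi, hiK, h1 | h1⟩
        · exact absurd ⟨i, hi, hiK, h1⟩ hc
        · exact ⟨i, hi, hiK, h1⟩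
  · intro i hi hix τ hτ hf hP
    have key : ((seq (seq (setNat 8 (var 20) (.const 0)) (for_ 21 0 0 (mark 8 (var 20) forced)))
        (ite (.both special (eq (var 20) (var 23))) (setNat 8 (var 20) (.const 2)) skip)).den
          τ).nat 8 x = τ.nat 8 x := by
      rw [den_seq, den_seq]
      have hf0 := (setNat 8 (var 20) (.const 0)).frame τ
      have e8 : ((setNat 8 (var 20) (.const 0)).den τ).nat 8 x = τ.nat 8 x := by
        simp [den, hτ, hix.symm]
      set τ₀ := (setNat 8 (var 20) (.const 0)).den τ
      have hτ0 : τ₀.nat 20 0 = i := by rw [hf0.nat 20 (by decide), hτ]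
      have hf1 := (for_ 21 0 0 (mark 8 (var 20) forced)).frame τ₀
      have e1 : ((for_ 21 0 0 (mark 8 (var 20) forced)).den τ₀).nat 8 x = τ.nat 8 x := by
        refine for_preserves (fun τ' => τ'.nat 8 x = τ.nat 8 x) (by decide) (by simp) ?_ e8
        intro j hj τ' hτ' hf' hP
        have : τ'.nat 20 0 = i := by rw [hf'.nat 20 (by decide), hτ0]
        simp only [mark, den]
        split_ifs
        · simp only [Memory.setNat_nat, eval_var, this, hix.symm, and_false, if_false, hP]
        · exact hP
      set τ₁ := (for_ 21 0 0 (mark 8 (var 20) forced)).den τ₀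
      have hτ1 : τ₁.nat 20 0 = i := by rw [hf1.nat 20 (by decide), hτ0]
      simp only [den]
      split_ifs
      · simp only [Memory.setNat_nat, eval_var, hτ1, hix.symm, and_false, if_false, e1]
      · exact e1
    simp only [key]
    exact hP

open Classical in
/-- The set of vertices that the solution of the current closure problem determines. -/
noncomputable def selected (n : ℕ) (σ : Memory) : Finset (Fin n) :=
  Finset.univ.filter fun v => σ.nat 8 v = 1 ∨ (σ.nat 8 v = 0 ∧ σ.nat 10 0 < σ.nat 9 v)

theorem mem_selected {v : Fin n} : v ∈ selected n σ ↔
    σ.nat 8 v = 1 ∨ (σ.nat 8 v = 0 ∧ σ.nat 10 0 < σ.nat 9 v) := by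
  simp [selected]

/-- The test for vertex `nat 20 0` to be selected. -/
def isSelected : Test :=
  or (eq (.cell 8 (var 20)) (.const 1))
    (.both (eq (.cell 8 (var 20)) (.const 0)) (.natLt (var 10) (.cell 9 (var 20))))

theorem holds_isSelected (v : Fin n) (hv : σ.nat 20 0 = v) :
    isSelected.Holds σ ↔ v ∈ selected n σ := by
  simp [isSelected, mem_selected, hv]

theorem Frame.selected_eq {p : LProg} {τ : Memory} (hf : Frame p σ τ)
    (hp : ∀ a ∈ [8, 9, 10], a ∉ p.natWrites) : selected n τ = selected n σ := by
  unfold selected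
  rw [hf.nat 8 (hp 8 (by decide)), hf.nat 9 (hp 9 (by decide)), hf.nat 10 (hp 10 (by decide))]

/-- Compute the weight of the selected set. -/
def total : LProg :=
  seq (setWt 3 (.const 0) .zero)
    (for_ 20 0 0 (ite isSelected
      (setWt 3 (.const 0) (.plus (.cell 3 (.const 0)) (.cell 0 (var 20)))) skip))

theorem total_spec (h : Loaded G K w σ) :
    (total.den σ).wt 3 0 = weight w (selected n σ) := by
  have hf0 := (setWt 3 (.const 0) .zero).frame σ
  have e3 : ((setWt 3 (.const 0) .zero).den σ).wt 3 0 = 0 := by simp [den]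
  rw [total, den_seq, ← hf0.selected_eq (by decide)]
  set σ₀ := (setWt 3 (.const 0) .zero).den σ
  have h0 := h.frame hf0 (by decide)
  have key := for_induction (v := 20) (b := 0) (k := 0) (σ := σ₀)
    (p := ite isSelected
      (setWt 3 (.const 0) (.plus (.cell 3 (.const 0)) (.cell 0 (var 20)))) skip)
    -- The partial sum over the selected vertices below the counter.
    (fun i τ => τ.wt 3 0 = weight w ((selected n σ₀).filter fun v : Fin n => (v : ℕ) < i))
    (by decide) ?_ ?_
  · rw [key, h0.size]
    congr 1
    exact Finset.filter_true_of_mem fun v _ => v.2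
  · simp [weight, e3]
  · intro i hi τ hτ hf hJ
    rw [add_zero, h0.size] at hi
    have hsel : isSelected.Holds τ ↔ (⟨i, hi⟩ : Fin n) ∈ selected n σ₀ := by
      rw [holds_isSelected ⟨i, hi⟩ hτ, hf.selected_eq (by decide)]
    have hL := h0.frame hf (by decide)
    rw [Memory.setNat_wt, den]
    by_cases hc : (⟨i, hi⟩ : Fin n) ∈ selected n σ₀
    · rw [if_pos (hsel.2 hc)]
      have hins : (selected n σ₀).filter (fun v : Fin n => (v : ℕ) < i + 1) =
          insert ⟨i, hi⟩ ((selected n σ₀).filter fun v : Fin n => (v : ℕ) < i) := by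
        ext v
        simp only [Finset.mem_filter, Finset.mem_insert]
        constructor
        · rintro ⟨h1, h2⟩
          by_cases hvi : (v : ℕ) = i
          · exact Or.inl (Fin.ext hvi)
          · exact Or.inr ⟨h1, by omega⟩
        · rintro (rfl | ⟨h1, h2⟩)
          · exact ⟨hc, Nat.lt_succ_self i⟩
          · exact ⟨h1, by omega⟩
      have hw : τ.wt 0 i = w ⟨i, hi⟩ := hL.weight ⟨i, hi⟩
      rw [hins]
      unfold weight at hJ ⊢
      rw [Finset.sum_insert (by simp), ← hJ]
      simp [den, hτ, hw, add_comm]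
    · rw [if_neg (fun hh => hc (hsel.1 hh)), den, hJ]
      congr 1
      ext v
      simp only [Finset.mem_filter]
      refine and_congr_right fun hv => ?_
      have : (v : ℕ) ≠ i := by
        rintro rfl
        exact hc hv
      omega

/-- Replace the output by the selected set if this increases its weight. -/
def update : LProg :=
  ite (.wtLt (.cell 4 (.const 0)) (.cell 3 (.const 0)))
    (seq (setWt 4 (.const 0) (.cell 3 (.const 0)))
      (for_ 20 0 0 (ite isSelected (setNat 3 (var 20) (.const 1)) (setNat 3 (var 20) (.const 0)))))
    skip

theorem update_of_lt (hn : σ.nat 0 0 = n) (hlt : σ.wt 4 0 < σ.wt 3 0) :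
    (update.den σ).wt 4 0 = σ.wt 3 0 ∧ output n (update.den σ) = selected n σ := by
  rw [update, den, if_pos (by exact hlt), den_seq]
  have hf0 := (setWt 4 (.const 0) (.cell 3 (.const 0))).frame σ
  have e4 : ((setWt 4 (.const 0) (.cell 3 (.const 0))).den σ).wt 4 0 = σ.wt 3 0 := by simp [den]
  set σ₀ := (setWt 4 (.const 0) (.cell 3 (.const 0))).den σ
  refine ⟨by rw [den_wt _ _ (by decide), e4], ?_⟩
  rw [← hf0.selected_eq (by decide)]
  have hn0 : σ₀.nat 0 0 = n := by rw [hf0.nat 0 (by decide), hn]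
  ext x
  simp only [output, Finset.mem_filter, Finset.mem_univ, true_and]
  refine for_point (fun τ => τ.nat 3 x = 1 ↔ x ∈ selected n σ₀) (x := x)
    (by rw [hn0]; exact x.2) (by decide) (by simp) ?_ ?_
  · intro τ hτ hf
    have hsel : isSelected.Holds τ ↔ x ∈ selected n σ₀ := by
      rw [holds_isSelected x hτ, hf.selected_eq (by decide)]
    rw [den]
    by_cases hc : x ∈ selected n σ₀
    · rw [if_pos (hsel.2 hc)]
      simp [den, hτ, hc]
    · rw [if_neg (fun hh => hc (hsel.1 hh))]
      simp [den, hτ, hc]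
  · intro i hi hix τ hτ hf hP
    rw [den]
    split_ifs
    · simpa [den, hτ, hix.symm] using hP
    · simpa [den, hτ, hix.symm] using hP

theorem update_of_not_lt (hlt : ¬ σ.wt 4 0 < σ.wt 3 0) : update.den σ = σ := by
  rw [update, den, if_neg (by exact hlt), den]

/-- Treat the closure problem with number `nat 23 0`. -/
def body : LProg := seq (seq status (seq pushRelabel gap)) (seq total update)

/-- The feasible sets among which the closure problem with number `c` finds an optimal one. -/
def candidates (G : SimpleGraph (Fin n)) (K : Set (Fin n)) (c : ℕ) : Set (Finset (Fin n)) :=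
  {F | ((¬ ∃ i : Fin n, (i : ℕ) = c ∧ i ∉ K) ∧ F ∈ filters (prec G K Kᶜ) Finset.univ) ∨
    ∃ i : Fin n, (i : ℕ) = c ∧ i ∉ K ∧
      ∃ T ∈ filters (prec G K Kᶜ) (ufs G K Kᶜ i), F = fos G K Kᶜ i ∪ T}

/-- Code 0 is `ufs(i)` and code 1 is `fos(i)`; the filter found in the former is optimal, and adding
the latter shifts all weights equally. -/
theorem selected_isMaxWeight (h : Loaded G K w σ) :
    IsMaxWeight (candidates G K (σ.nat 23 0)) w
      (selected n ((seq status (seq pushRelabel gap)).den σ)) := by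
  rw [den_seq]
  have hst := status_spec h
  have hL := h.frame (status.frame σ) (by decide)
  set τ := status.den σ
  have hf := (seq pushRelabel gap).frame τ
  have hmem : ∀ v, v ∈ selected n ((seq pushRelabel gap).den τ) ↔ τ.nat 8 v = 1 ∨
      (τ.nat 8 v = 0 ∧ ((seq pushRelabel gap).den τ).nat 10 0 <
        ((seq pushRelabel gap).den τ).nat 9 v) := by
    intro v
    rw [mem_selected, hf.nat 8 (by decide)]
  by_cases hsp : ∃ i : Fin n, (i : ℕ) = σ.nat 23 0 ∧ i ∉ K
  · obtain ⟨i, hi, hiK⟩ := hsp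
    have huniq : ∀ j : Fin n, (j : ℕ) = σ.nat 23 0 → j = i := fun j hj =>
      Fin.ext (hj.trans hi.symm)
    have h2 : ∀ x : Fin n, τ.nat 8 x = 2 ↔ x = i := by
      intro x
      rw [(hst x).2.1]
      constructor
      · rintro ⟨j, hj, -, rfl⟩; exact huniq _ hj
      · rintro rfl; exact ⟨x, hi, hiK, rfl⟩
    have h0 : ∀ x : Fin n, 0 < τ.nat 8 x ↔ x = i ∨ x ∈ fos G K Kᶜ i := by
      intro x
      rw [(hst x).2.2]
      constructor
      · rintro ⟨j, hj, -, hx⟩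
        rwa [huniq j hj] at hx
      · intro hx; exact ⟨i, hi, hiK, hx⟩
    have hfree : ∀ x : Fin n, τ.nat 8 x = 0 ↔ x ∈ ufs G K Kᶜ i := by
      intro x
      rw [mem_ufs, ← Nat.le_zero, ← not_lt, h0]
      tauto
    have hone : ∀ x : Fin n, τ.nat 8 x = 1 ↔ x ∈ fos G K Kᶜ i := by
      intro x
      have a1 := (hst x).1
      have a2 := h2 x
      have a3 := h0 x
      have a4 : x = i → x ∉ fos G K Kᶜ i := by
        rintro rfl hx
        rcases mem_fos.1 hx with hx | hx
        · exact hiK hx.1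
        · exact hx.2 le_rfl
      constructor
      · intro hx
        rcases a3.1 (by omega) with hx' | hx'
        · have := a2.2 hx'; omega
        · exact hx'
      · intro hx
        have b1 := a3.2 (Or.inr hx)
        have b2 : τ.nat 8 x ≠ 2 := fun hh => a4 (a2.1 hh) hx
        omega
    set T := (ufs G K Kᶜ i).filter fun v : Fin n => ((seq pushRelabel gap).den τ).nat 10 0 <
      ((seq pushRelabel gap).den τ).nat 9 v with hT
    have hmax : IsMaxWeight (filters (prec G K Kᶜ) (ufs G K Kᶜ i)) w T :=
      closure_spec ⟨hL, hfree⟩ fun v => by rw [hT, Finset.mem_filter]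
    have hsel : selected n ((seq pushRelabel gap).den τ) = fos G K Kᶜ i ∪ T := by
      ext v
      rw [hmem, Finset.mem_union, hT, Finset.mem_filter, hone, hfree]
    rw [hsel]
    refine ⟨Or.inr ⟨i, hi, hiK, T, hmax.1, rfl⟩, ?_⟩
    rintro F (⟨hn, -⟩ | ⟨j, hj, -, T', hT', rfl⟩)
    · exact absurd ⟨i, hi, hiK⟩ hn
    · obtain rfl := huniq j hj
      rw [weight_union w (disjoint_fos_of_subset_ufs hT'.1),
        weight_union w (disjoint_fos_of_subset_ufs hmax.1.1)]
      exact add_le_add_right (hmax.2 T' hT') _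
  · have h0 : ∀ x : Fin n, τ.nat 8 x = 0 := by
      intro x
      have a1 := (hst x).2.2.not.2 (by rintro ⟨i, hi, hiK, -⟩; exact hsp ⟨i, hi, hiK⟩)
      omega
    have hmax : IsMaxWeight (filters (prec G K Kᶜ) Finset.univ) w
        (selected n ((seq pushRelabel gap).den τ)) :=
      closure_spec ⟨hL, fun x => by simp [h0]⟩ fun v => by rw [hmem, h0]; simp
    refine ⟨Or.inl ⟨hsp, hmax.1⟩, ?_⟩
    rintro F (⟨-, hF⟩ | ⟨i, hi, hiK, -⟩)
    · exact hmax.2 F hF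
    · exact absurd ⟨i, hi, hiK⟩ hsp

theorem candidates_feasible (hK : IsSplitPartition G K Kᶜ) {c : ℕ} {F : Finset (Fin n)}
    (hF : F ∈ candidates G K c) : F ∈ feasibleSets G := by
  rcases hF with ⟨-, hF⟩ | ⟨i, -, hiK, T, hT, rfl⟩
  · exact hK.filter_feasible Finset.mem_univ hF
  · exact hK.fos_union_feasible hiK hT

/-- The number `n` is no vertex and therefore stands for the closure problem on all of `V`. Clique
vertices repeat that problem, which is harmless. -/
theorem exists_candidates (hK : IsSplitPartition G K Kᶜ) {F : Finset (Fin n)}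
    (hF : F ∈ feasibleSets G) : ∃ c < n + 1, F ∈ candidates G K c := by
  rcases hK.feasible_cases hF with hF | ⟨i, hi, T, hT, rfl⟩
  · refine ⟨n, Nat.lt_succ_self n, Or.inl ⟨?_, hF⟩⟩
    rintro ⟨i, hi, -⟩
    exact absurd hi i.2.ne
  · exact ⟨i, i.2.trans (Nat.lt_succ_self n), Or.inr ⟨i, rfl, hi, T, hT, rfl⟩⟩

theorem body_spec (hK : IsSplitPartition G K Kᶜ) (h : Loaded G K w σ)
    (hout : output n σ ∈ feasibleSets G ∧ σ.wt 4 0 = weight w (output n σ)) :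
    (output n (body.den σ) ∈ feasibleSets G ∧
      (body.den σ).wt 4 0 = weight w (output n (body.den σ))) ∧
    σ.wt 4 0 ≤ (body.den σ).wt 4 0 ∧
    ∀ F ∈ candidates G K (σ.nat 23 0), weight w F ≤ (body.den σ).wt 4 0 := by
  rw [body, den_seq, den_seq]
  have hmax := selected_isMaxWeight h
  have hf1 := (seq status (seq pushRelabel gap)).frame σ
  set σ₁ := (seq status (seq pushRelabel gap)).den σ
  have hL1 := h.frame hf1 (by decide)
  have ht := total_spec hL1
  have hf2 := total.frame σ₁
  rw [← hf2.selected_eq (by decide)] at hmax ht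
  set σ₂ := total.den σ₁
  have hL2 := hL1.frame hf2 (by decide)
  have e4 : σ₂.wt 4 0 = σ.wt 4 0 := by rw [hf2.wt 4 (by decide), hf1.wt 4 (by decide)]
  have eo : output n σ₂ = output n σ := by
    unfold output
    rw [hf2.nat 3 (by decide), hf1.nat 3 (by decide)]
  by_cases hlt : σ₂.wt 4 0 < σ₂.wt 3 0
  · obtain ⟨h1, h2⟩ := update_of_lt hL2.size hlt
    rw [h1, h2]
    exact ⟨⟨candidates_feasible hK hmax.1, ht⟩, by linarith, fun F hF => ht ▸ hmax.2 F hF⟩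
  · rw [update_of_not_lt hlt, eo, e4]
    refine ⟨hout, le_rfl, fun F hF => ?_⟩
    have := hmax.2 F hF
    linarith

/-- The program that finds a feasible set of maximum weight. -/
def program : LProg := seq preprocess (for_ 23 0 1 body)

theorem program_spec {es : List (Fin n × Fin n)} (hG : IsSplit G) (hes : IsEdgeList G es)
    (w : Fin n → ℝ) :
    IsMaxWeight (feasibleSets G) w (output n (program.den (input n es w))) := by
  have hK := isSplitPartition_canonicalClique hG
  have hL := preprocess_spec hes w
  have hf := preprocess.frame (input n es w)
  rw [program, den_seq]
  set σ := preprocess.den (input n es w)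
  set K := canonicalClique G
  have hout : output n σ = ∅ := by
    unfold output
    rw [hf.nat 3 (by decide)]
    simp [input]
  have hw : σ.wt 4 0 = 0 := by
    rw [hf.wt 4 (by decide)]
    simp [input]
  have key := for_induction (v := 23) (b := 0) (k := 1) (p := body) (σ := σ)
    (fun i τ => (output n τ ∈ feasibleSets G ∧ τ.wt 4 0 = weight w (output n τ)) ∧
      ∀ c < i, ∀ F ∈ candidates G K c, weight w F ≤ τ.wt 4 0) (by decide) ?_ ?_
  · obtain ⟨⟨h1, h2⟩, h3⟩ := key
    refine ⟨h1, fun F hF => ?_⟩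
    obtain ⟨c, hc, hF⟩ := exists_candidates hK hF
    rw [← h2]
    exact h3 c (by rw [hL.size]; exact hc) F hF
  -- Untouched memory already encodes a legitimate first candidate: the empty set with weight 0.
  · refine ⟨?_, fun c hc => absurd hc (Nat.not_lt_zero c)⟩
    have : output n (σ.setNat 23 0 0) = ∅ := by
      rw [← hout]
      unfold output
      rw [Memory.setNat_nat_ne _ _ _ (by decide)]
    rw [this, Memory.setNat_wt, hw]
    exact ⟨empty_mem_feasibleSets G, by simp [weight]⟩
  · rintro i hi τ hτ hf' ⟨h1, h2⟩
    obtain ⟨h3, h4, h5⟩ := body_spec hK (hL.frame hf' (by decide)) h1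
    have : output n ((body.den τ).setNat 23 0 (i + 1)) = output n (body.den τ) := by
      unfold output
      rw [Memory.setNat_nat_ne _ _ _ (by decide)]
    rw [this, Memory.setNat_wt]
    refine ⟨h3, fun c hc F hF => ?_⟩
    by_cases hci : c = i
    · rw [hci, ← hτ] at hF
      exact h5 F hF
    · exact (h2 c (by omega) F hF).trans h4

theorem exists_polynomial_program :
    ∃ (P : Prog) (p : Polynomial ℕ),
      ∀ (n : ℕ) (G : SimpleGraph (Fin n)) (es : List (Fin n × Fin n)) (w : Fin n → ℝ),
        IsSplit G → IsEdgeList G es →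
          ∃ (t : ℕ) (τ : Memory), Runs P (input n es w) t τ ∧ t ≤ p.eval (n + es.length) ∧
            IsMaxWeight (feasibleSets G) w (output n τ) := by
  obtain ⟨q, hq⟩ := program.time_le_polynomial
  refine ⟨program.compile, q, fun n G es w hG hes => ?_⟩
  obtain ⟨t, ht, hr⟩ := program.runs_compile (by decide) (by decide) (input n es w)
  refine ⟨t, _, hr, ht.trans (hq _ _ fun j => ?_), program_spec hG hes w⟩
  -- Every cell of array `0` is `n`, the number of listed pairs, or 0.
  simp only [input]
  split_ifs <;> omega

end LProg

end MainProgram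

end SplitShelling

open SplitShelling in
theorem mainTheorem4 :
    -- a maximum weight feasible set is found in polynomial time
    (∃ (P : Prog) (p : Polynomial ℕ),
      ∀ (n : ℕ) (G : SimpleGraph (Fin n)) (es : List (Fin n × Fin n)) (w : Fin n → ℝ),
        IsSplit G → IsEdgeList G es →
          ∃ (t : ℕ) (τ : Memory), Runs P (input n es w) t τ ∧ t ≤ p.eval (n + es.length) ∧
            IsMaxWeight (feasibleSets G) w (output n τ)) ∧
    -- the decomposition into `|I| + 1` maximum closure problems, and their reduction to maximum flow
    (∀ (V : Type) [Fintype V] [DecidableEq V] (G : SimpleGraph V) (K I : Set V) (w : V → ℝ),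
      IsSplitPartition G K I →
        (∀ (S : Finset V) (T : V → Finset V),
          IsMaxWeight (filters (prec G K I) Finset.univ) w S →
          (∀ i ∈ I, IsMaxWeight (filters (prec G K I) (ufs G K I i)) w (T i)) →
          ∀ F : Finset V,
            IsMaxWeight ({S} ∪ {F' | ∃ i ∈ I, F' = fos G K I i ∪ T i}) w F →
              IsMaxWeight (feasibleSets G) w F) ∧
        (∀ (U : Finset V), U = Finset.univ ∨ (∃ i ∈ I, U = ufs G K I i) →
          ∀ f : Node V → Node V → NNReal,
            IsMaxFlow (picard (prec G K I) U w) source sink f →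
              IsMaxWeight (filters (prec G K I) U) w (sourceSide (prec G K I) U w f))) :=
  ⟨LProg.exists_polynomial_program, fun _ _ _ _ _ _ w h =>
    ⟨fun _ _ hS hT _ hF => h.isMaxWeight_of_closures w hS hT hF,
      fun _ _ _ hf => isMaxWeight_sourceSide hf⟩⟩
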